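/- Let $N>M\ge 0$ be integers and let $\varepsilon_i=1$ for $1\le i\le N$, $\varepsilon_i=-1$ for $N<i\le N+M$. Consider fields $u^i(x,\tau)$, $1\le i\le N+M$ (all real or all complex), of the form $u^i=e^{\tilde u^i}$, that is, $\tilde u^i=\log u^i$, and the rational Lax function $$\mathcal L=\prod_{i=1}^{N+M}(p+u^i)^{\varepsilon_i},$$ whose numerator and denominator have no common root. For $n\ge1$ the $n$-th flow is given by the Lax equation $$\frac{\partial\mathcal L}{\partial\tau_n}=\big\{(\mathcal L^{n/(N-M)})_+,\mathcal L\big\},\qquad \{f,g\}=p\,(\partial_pf\,\partial_xg-\partial_xf\,\partial_pg),$$ where $\mathcal L^{n/(N-M)}=p^n\prod_i(1+u^i/p)^{\varepsilon_i n/(N-M)}$ is expanded formally at $p=\infty$ and $(\ )_+$ is its part with non-negative powers of $p$. With generalized binomial coefficients (equal to $0$ for a negative lower entry), put $$A_i^{(n)}=\Big(\tfrac{\varepsilon_i n}{N-M}-1\Big)\sum_{\sum_k r_k=n}\Big[\prod_{k\ne i}\binom{\frac{\varepsilon_k n}{N-M}}{r_k}(u^k)^{r_k}\Big]\binom{\frac{\varepsilon_i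 n}{N-M}-2}{r_i-1}(u^i)^{r_i},$$ $$B_{ij}^{(n)}=\tfrac{\varepsilon_j n}{N-M}\sum_{\sum_k r_k=n-1}\Big[\prod_{k\ne i,j}\binom{\frac{\varepsilon_k n}{N-M}}{r_k}(u^k)^{r_k}\Big]\binom{\frac{\varepsilon_i n}{N-M}-1}{r_i}(u^i)^{r_i}\binom{\frac{\varepsilon_j n}{N-M}-1}{r_j}(u^j)^{r_j}.$$ Let $Q^{(n)}=\frac1{2\pi i}\oint\mathcal L^{n/(N-M)}\frac{dp}{p}$, i.e. the coefficient of $p^0$ in the expansion at $p=\infty$, and $$H^{(n)}=\frac1n\int Q^{(n)}\,dx.$$ Let $m=(m^{ij})$ be the constant $(N+M)\times(N+M)$ matrix with diagonal entries $m^{ii}=1-\varepsilon_i(N-M)$ and all other entries $1$. A pair $(g^{ij}(u),\Gamma^{ij}_k(u))$ is said to define a Hamiltonian structure if $$\{I,J\}=\int\sum_{i,j}\frac{\delta I}{\delta u^i}\Big(g^{ij}\mathcal D+\sum_k\Gamma^{ij}_ku^k_x\Big)\frac{\delta J}{\delta u^j}\,dx,$$ where $\mathcal D$ is the total $x$-derivative,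 is skew-symmetric and satisfies the Jacobi identity on all local functionals, that is, functionals whose densities are smooth functions of $u$ and of finitely many $x$-derivatives of $u$, taken modulo total $x$-derivatives. **(A)** One has $$Q^{(n)}=\sum_{\sum_k r_k=n}\ \prod_{i=1}^{N+M}\binom{\frac{\varepsilon_i n}{N-M}}{r_i}(u^i)^{r_i}.$$ The pair $(m,0)$ defines a Hamiltonian structure, and for every $n\ge 1$ and for continuously differentiable fields on an open set of the $(x,\tau)$-plane, each of the $n$-th Lax equation and the explicit evolution equations $u^i_{\tau_n}=A_i^{(n)}u^i_x+\sum_{j\ne i}u^iB_{ij}^{(n)}u^j_x$ is equivalent to $$\tilde u^i_{\tau_n}=\sum_j m^{ij}\,\mathcal D\Big(\frac{\delta H^{(n)}}{\delta\tilde u^j}\Big),\qquad 1\le i\le N+M .$$ **(B)** In the original variables, the pair $$g^{ij}(u)=m^{ij}u^iu^j,\qquad \Gamma^{ij}_k(u)=\delta^j_k\,m^{ij}u^i$$ satisfies the Grinberg–Dorfman conditions (with summation over repeated indices) $$g^{ij}=g^{ji},\qquad \frac{\partial g^{ij}}{\partial u^k}=\Gamma^{ij}_k+\Gamma^{ji}_k,\qquad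 g^{ij}\Gamma^{rs}_i=g^{ri}\Gamma^{js}_i,$$ $$\Gamma^{ij}_t\Gamma^{tk}_r-\Gamma^{ik}_t\Gamma^{tj}_r=g^{ti}\Big(\frac{\partial\Gamma^{jk}_r}{\partial u^t}-\frac{\partial\Gamma^{jk}_t}{\partial u^r}\Big),$$ $$\sum_{\mathrm{cyclic}\ i,j,k}\Big[\Big(\frac{\partial\Gamma^{ij}_t}{\partial u^q}-\frac{\partial\Gamma^{ij}_q}{\partial u^t}\Big)\Gamma^{tk}_r+\Big(\frac{\partial\Gamma^{ij}_t}{\partial u^r}-\frac{\partial\Gamma^{ij}_r}{\partial u^t}\Big)\Gamma^{tk}_q\Big]=0,$$ and it defines a Hamiltonian structure, with respect to which the above evolution equations are the Hamiltonian system with Hamiltonian $H^{(n)}$: $$u^i_{\tau_n}=\sum_j\Big(g^{ij}\mathcal D+\sum_k\Gamma^{ij}_ku^k_x\Big)\frac{\delta H^{(n)}}{\delta u^j}.$$ This structure is degenerate: $\det(g^{ij})=0$ for all $u$, and $\operatorname{rank}(g^{ij})=N+M-1$ wherever all $u^i\ne0$. -/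

import Mathlib

open scoped ContDiff

noncomputable section

namespace RationalLax

/-! ### Formal calculus of variations

Fields `u = (u^i)`, `i ∈ ι`, with values in `𝕜` (`ℝ` or `ℂ`), depend on one real variable `x`.  A point
of the infinite jet space is `a : ℕ → ι → 𝕜`, with `a k i` in the role of `∂_x^k u^i`. -/

section Variational

variable {𝕜 : Type*} [RCLike 𝕜] {ι : Type*} [Fintype ι] [DecidableEq ι]

/-- Differential functions over `U`: smooth functions of `u ∈ U` and of finitely many
`x`-derivatives of `u`. These are the densities of the local functionals `∫ f(u, u_x, u_xx, …) dx`. -/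
def IsDiffFun (U : Set (ι → 𝕜)) (f : (ℕ → ι → 𝕜) → 𝕜) : Prop :=
  ∃ (k : ℕ) (F : (Fin (k + 1) → ι → 𝕜) → 𝕜),
    ContDiffOn 𝕜 ∞ F {b | b 0 ∈ U} ∧ ∀ a : ℕ → ι → 𝕜, a 0 ∈ U → f a = F (fun l => a l)

/-- The partial derivative `∂f/∂u^i_{(k)}`. -/
def jetPartial (k : ℕ) (i : ι) (f : (ℕ → ι → 𝕜) → 𝕜) (a : ℕ → ι → 𝕜) : 𝕜 :=
  deriv (fun t : 𝕜 => f (Function.update a k (Function.update (a k) i t))) (a k i)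

/-- The total `x`-derivative `𝒟 f = ∑_{k,i} u^i_{(k+1)} ∂f/∂u^i_{(k)}`
(a finite sum for a differential function). -/
def totalD (f : (ℕ → ι → 𝕜) → 𝕜) (a : ℕ → ι → 𝕜) : 𝕜 :=
  ∑ᶠ k : ℕ, ∑ i : ι, a (k + 1) i * jetPartial k i f a

/-- The variational derivative `δ/δu^i ∫ f dx = ∑_k (-𝒟)^k ∂f/∂u^i_{(k)}`. -/
def varDeriv (f : (ℕ → ι → 𝕜) → 𝕜) (i : ι) (a : ℕ → ι → 𝕜) : 𝕜 :=
  ∑ᶠ k : ℕ, (-1) ^ k * (totalD^[k] (jetPartial k i f)) a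

/-- The density `f` defines the zero functional: `f` is a total derivative (over `U`). -/
def IsTotalDeriv (U : Set (ι → 𝕜)) (f : (ℕ → ι → 𝕜) → 𝕜) : Prop :=
  ∃ h, IsDiffFun U h ∧ ∀ a : ℕ → ι → 𝕜, a 0 ∈ U → f a = totalD h a

/-- The operator `A^{ij} = g^{ij}(u) 𝒟 + ∑_k Γ^{ij}_k(u) u^k_x` applied to `q = (q_j)`:
the `i`-th component of `∑_j A^{ij} q_j`. Here `Γ u i j k` stands for `Γ^{ij}_k(u)`. -/
def hydroOp (g : (ι → 𝕜) → Matrix ι ι 𝕜) (Γ : (ι → 𝕜) → ι → ι → ι → 𝕜)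
    (q : ι → (ℕ → ι → 𝕜) → 𝕜) (i : ι) (a : ℕ → ι → 𝕜) : 𝕜 :=
  ∑ j, (g (a 0) i j * totalD (q j) a + (∑ k, Γ (a 0) i j k * a 1 k) * q j a)

/-- The density `∑_{i,j} (δI/δu^i) A^{ij} (δJ/δu^j)` of the bracket `{I, J}` of the functionals
`I = ∫ f dx` and `J = ∫ h dx`. -/
def hydroBracket (g : (ι → 𝕜) → Matrix ι ι 𝕜) (Γ : (ι → 𝕜) → ι → ι → ι → 𝕜)
    (f h : (ℕ → ι → 𝕜) → 𝕜) (a : ℕ → ι → 𝕜) : 𝕜 :=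
  ∑ i, varDeriv f i a * hydroOp g Γ (varDeriv h) i a

/-- The pair `(g, Γ)` defines a Hamiltonian structure of hydrodynamic type over `U`: the bracket of
local functionals is skew-symmetric and satisfies the Jacobi identity. -/
structure IsHamiltonianStructure (U : Set (ι → 𝕜)) (g : (ι → 𝕜) → Matrix ι ι 𝕜)
    (Γ : (ι → 𝕜) → ι → ι → ι → 𝕜) : Prop where
  smooth_g : ∀ i j, ContDiffOn 𝕜 ∞ (fun u => g u i j) U
  smooth_Γ : ∀ i j k, ContDiffOn 𝕜 ∞ (fun u => Γ u i j k) U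
  skew : ∀ f h, IsDiffFun U f → IsDiffFun U h →
    IsTotalDeriv U (fun a => hydroBracket g Γ f h a + hydroBracket g Γ h f a)
  jacobi : ∀ f₁ f₂ f₃, IsDiffFun U f₁ → IsDiffFun U f₂ → IsDiffFun U f₃ →
    IsTotalDeriv U (fun a => hydroBracket g Γ (hydroBracket g Γ f₁ f₂) f₃ a
      + hydroBracket g Γ (hydroBracket g Γ f₂ f₃) f₁ a
      + hydroBracket g Γ (hydroBracket g Γ f₃ f₁) f₂ a)

/-- The partial derivative `∂f/∂u^k` of a function on `𝕜^ι`. -/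
def coordPartial (k : ι) (f : (ι → 𝕜) → 𝕜) (u : ι → 𝕜) : 𝕜 :=
  deriv (fun t : 𝕜 => f (Function.update u k t)) (u k)

/-- `∑_t [(∂Γ^{ij}_t/∂u^q - ∂Γ^{ij}_q/∂u^t) Γ^{tk}_r + (∂Γ^{ij}_t/∂u^r - ∂Γ^{ij}_r/∂u^t) Γ^{tk}_q]`. -/
def gdTerm (Γ : (ι → 𝕜) → ι → ι → ι → 𝕜) (u : ι → 𝕜) (q r i j k : ι) : 𝕜 :=
  ∑ t, ((coordPartial q (fun v => Γ v i j t) u - coordPartial t (fun v => Γ v i j q) u) * Γ u t k r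
    + (coordPartial r (fun v => Γ v i j t) u - coordPartial t (fun v => Γ v i j r) u) * Γ u t k q)

/-- The conditions of Grinberg and Dorfman on a pair `(g, Γ)` of smooth functions on `U`. -/
structure GrinbergDorfman (U : Set (ι → 𝕜)) (g : (ι → 𝕜) → Matrix ι ι 𝕜)
    (Γ : (ι → 𝕜) → ι → ι → ι → 𝕜) : Prop where
  smooth_g : ∀ i j, ContDiffOn 𝕜 ∞ (fun u => g u i j) U
  smooth_Γ : ∀ i j k, ContDiffOn 𝕜 ∞ (fun u => Γ u i j k) U
  symm : ∀ u ∈ U, ∀ i j, g u i j = g u j i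
  compat : ∀ u ∈ U, ∀ i j k, coordPartial k (fun v => g v i j) u = Γ u i j k + Γ u j i k
  torsion : ∀ u ∈ U, ∀ j r s, ∑ i, g u i j * Γ u r s i = ∑ i, g u r i * Γ u j s i
  curvature : ∀ u ∈ U, ∀ i j k r,
    ∑ t, (Γ u i j t * Γ u t k r - Γ u i k t * Γ u t j r)
      = ∑ t, g u t i
          * (coordPartial t (fun v => Γ v j k r) u - coordPartial r (fun v => Γ v j k t) u)
  cyclic : ∀ u ∈ U, ∀ i j k q r,
    gdTerm Γ u q r i j k + gdTerm Γ u q r j k i + gdTerm Γ u q r k i j = 0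

/-- The jet at `x` of a field `w` on the line. -/
def jet (w : ℝ → ι → 𝕜) (x : ℝ) : ℕ → ι → 𝕜 :=
  fun k i => iteratedDeriv k (fun y => w y i) x

/-- The field `w = w(x, τ)` satisfies on `Ω` the Hamiltonian system
`w^i_τ = ∑_j (g^{ij} 𝒟 + ∑_k Γ^{ij}_k w^k_x) (δH/δw^j)` with `H = ∫ h dx`. -/
def IsHamiltonianFlow (g : (ι → 𝕜) → Matrix ι ι 𝕜) (Γ : (ι → 𝕜) → ι → ι → ι → 𝕜)
    (h : (ℕ → ι → 𝕜) → 𝕜) (Ω : Set (ℝ × ℝ)) (w : ℝ → ℝ → ι → 𝕜) : Prop :=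
  ∀ x τ, (x, τ) ∈ Ω → ∀ i,
    deriv (fun s => w x s i) τ = hydroOp g Γ (varDeriv h) i (jet (fun y => w y τ) x)

end Variational

/-! ### The rational Lax hierarchy

The zeros and poles of `L` are labelled by `Fin N ⊕ Fin M`: the `N` zeros first, then the `M` poles. -/

section Lax

variable {𝕜 : Type*} [RCLike 𝕜] {N M : ℕ}

/-- `ε_i = 1` for the zeros and `ε_i = -1` for the poles. -/
def eps : Fin N ⊕ Fin M → ℤ := Sum.elim (fun _ => 1) (fun _ => -1)

/-- The Lax function `L(p) = ∏_i (p + u^i)^{ε_i}`. -/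
def lax (u : Fin N ⊕ Fin M → 𝕜) (p : 𝕜) : 𝕜 := ∏ i, (p + u i) ^ (eps i)

/-- The exponent `ε_i n / (N - M)` of `p + u^i` in `L^{n/(N-M)}`. -/
def laxExp (n : ℕ) (i : Fin N ⊕ Fin M) : ℚ := (eps i : ℚ) * n / ((N : ℚ) - M)

/-- The expansion of `L^{n/(N-M)}` at `p = ∞`, namely `p^n ∏_i (1 + u^i/p)^{ε_i n/(N-M)}`,
as a formal Laurent series in the variable `1/p`. -/
def laxPow (n : ℕ) (u : Fin N ⊕ Fin M → 𝕜) : LaurentSeries 𝕜 :=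
  HahnSeries.single (-(n : ℤ)) 1 *
    HahnSeries.ofPowerSeries ℤ 𝕜
      (∏ i, PowerSeries.rescale (u i) (PowerSeries.binomialSeries 𝕜 (laxExp n i)))

/-- The part `(L^{n/(N-M)})_+` with non-negative powers of `p`, a polynomial in `p`. -/
def laxPlus (n : ℕ) (u : Fin N ⊕ Fin M → 𝕜) : Polynomial 𝕜 :=
  ∑ k ∈ Finset.range (n + 1), Polynomial.monomial k ((laxPow n u).coeff (-(k : ℤ)))

/-- The residue charge density `Q^{(n)} = (1/2πi) ∮ L^{n/(N-M)} dp/p`, i.e. the coefficient of `p^0`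
in the expansion of `L^{n/(N-M)}` at `p = ∞`. -/
def charge (n : ℕ) (u : Fin N ⊕ Fin M → 𝕜) : 𝕜 := (laxPow n u).coeff 0

/-- The bracket `{f, g} = p (∂_p f ∂_x g - ∂_x f ∂_p g)` of functions of `(x, p)`. -/
def laxBracket (f g : ℝ → 𝕜 → 𝕜) (x : ℝ) (p : 𝕜) : 𝕜 :=
  p * (deriv (fun q => f x q) p * deriv (fun y => g y p) x
    - deriv (fun y => f y p) x * deriv (fun q => g x q) p)

/-- The Lax equation `∂L/∂τ = {(L^{n/(N-M)})_+, L}` on `Ω`, as an identity between rational functions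
of `p` (that is, for all `p` which are neither zeros nor poles of `L`). -/
def IsLaxFlow (n : ℕ) (Ω : Set (ℝ × ℝ)) (u : ℝ → ℝ → Fin N ⊕ Fin M → 𝕜) : Prop :=
  ∀ x τ, (x, τ) ∈ Ω → ∀ p : 𝕜, (∀ i, p + u x τ i ≠ 0) →
    deriv (fun s => lax (u x s) p) τ
      = laxBracket (fun y q => (laxPlus n (u y τ)).eval q) (fun y q => lax (u y τ) q) x p

/-- The binomial coefficient with an integer lower argument (zero when that is negative). -/
def binom (a : ℚ) (b : ℤ) : ℚ := if b < 0 then 0 else Ring.choose a b.toNat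

/-- The explicit sum
`∑_{∑ r_i = n} ∏_i binom(ε_i n/(N-M), r_i) (u^i)^{r_i}`. -/
def chargeSum (n : ℕ) (u : Fin N ⊕ Fin M → 𝕜) : 𝕜 :=
  ∑ r ∈ Finset.piAntidiag Finset.univ n, ∏ i, ((binom (laxExp n i) (r i) : ℚ) : 𝕜) * u i ^ r i

/-- The coefficient `A_i^{(n)}` of the evolution equations in the modified variables. -/
def flowA (n : ℕ) (i : Fin N ⊕ Fin M) (u : Fin N ⊕ Fin M → 𝕜) : 𝕜 :=
  ((laxExp n i - 1 : ℚ) : 𝕜) * ∑ r ∈ Finset.piAntidiag Finset.univ n,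
    (∏ k ∈ Finset.univ.erase i, ((binom (laxExp n k) (r k) : ℚ) : 𝕜) * u k ^ r k)
      * (((binom (laxExp n i - 2) ((r i : ℤ) - 1) : ℚ) : 𝕜) * u i ^ r i)

/-- The coefficient `B_{ij}^{(n)}` of the evolution equations in the modified variables. -/
def flowB (n : ℕ) (i j : Fin N ⊕ Fin M) (u : Fin N ⊕ Fin M → 𝕜) : 𝕜 :=
  ((laxExp n j : ℚ) : 𝕜) * ∑ r ∈ Finset.piAntidiag Finset.univ (n - 1),
    (∏ k ∈ (Finset.univ.erase i).erase j, ((binom (laxExp n k) (r k) : ℚ) : 𝕜) * u k ^ r k)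
      * (((binom (laxExp n i - 1) (r i) : ℚ) : 𝕜) * u i ^ r i)
      * (((binom (laxExp n j - 1) (r j) : ℚ) : 𝕜) * u j ^ r j)

/-- The evolution equations `u^i_τ = A_i^{(n)} u^i_x + ∑_{j ≠ i} u^i B_{ij}^{(n)} u^j_x` on `Ω`. -/
def IsModifiedFlow (n : ℕ) (Ω : Set (ℝ × ℝ)) (u : ℝ → ℝ → Fin N ⊕ Fin M → 𝕜) : Prop :=
  ∀ x τ, (x, τ) ∈ Ω → ∀ i,
    deriv (fun s => u x s i) τ
      = flowA n i (u x τ) * deriv (fun y => u y τ i) x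
        + ∑ j ∈ Finset.univ.erase i,
            u x τ i * flowB n i j (u x τ) * deriv (fun y => u y τ j) x

/-- The constant matrix with diagonal entries `1 - ε_i (N - M)` and all other entries `1`. -/
def mMat (𝕜 : Type*) [RCLike 𝕜] (N M : ℕ) : Matrix (Fin N ⊕ Fin M) (Fin N ⊕ Fin M) 𝕜 :=
  fun i j => if i = j then 1 - ((eps i : ℤ) : 𝕜) * ((N : 𝕜) - M) else 1

/-- `g^{ij}(u) = m^{ij} u^i u^j`. -/
def gMat (u : Fin N ⊕ Fin M → 𝕜) : Matrix (Fin N ⊕ Fin M) (Fin N ⊕ Fin M) 𝕜 :=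
  fun i j => mMat 𝕜 N M i j * u i * u j

/-- `Γ^{ij}_k(u) = δ^j_k m^{ij} u^i`. -/
def gammaSym (u : Fin N ⊕ Fin M → 𝕜) (i j k : Fin N ⊕ Fin M) : 𝕜 :=
  if j = k then mMat 𝕜 N M i j * u i else 0

/-- The Hamiltonian density `(1/n) Q^{(n)}` in the variables `u^i`. -/
def hamDensity (n : ℕ) (a : ℕ → Fin N ⊕ Fin M → 𝕜) : 𝕜 := (n : 𝕜)⁻¹ * charge n (a 0)

/-- The Hamiltonian density `(1/n) Q^{(n)}` in the variables `ũ^i = log u^i`. -/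
def hamDensityLog (n : ℕ) (a : ℕ → Fin N ⊕ Fin M → 𝕜) : 𝕜 :=
  (n : 𝕜)⁻¹ * charge n (fun i => NormedSpace.exp (a 0 i))

/-- `laxPow n u` is indeed an `(N - M)`-th root of `L^n`, in the field of Laurent series in `1/p`,
where `p` is `single (-1) 1`. -/
theorem laxPow_pow (hNM : M < N) (n : ℕ) (u : Fin N ⊕ Fin M → 𝕜) :
    laxPow n u ^ (N - M)
      = (∏ i, (HahnSeries.single (-1 : ℤ) (1 : 𝕜) + HahnSeries.C (u i) : LaurentSeries 𝕜) ^ (eps i))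
          ^ n := by
  have hd : ((N : ℚ) - M) ≠ 0 := by
    have : (M : ℚ) < N := by exact_mod_cast hNM
    linarith
  have hpow : ∀ (k : ℕ) (r : ℚ), PowerSeries.binomialSeries 𝕜 r ^ k
      = PowerSeries.binomialSeries 𝕜 (k * r) := by
    intro k r
    induction k with
    | zero => simp
    | succ k ih =>
      rw [pow_succ, ih, ← PowerSeries.binomialSeries_add]
      congr 1
      push_cast
      ring
  -- the Laurent polynomial `1 + u/p`
  let W : 𝕜 → LaurentSeries 𝕜 := fun v =>
    HahnSeries.ofPowerSeries ℤ 𝕜 (PowerSeries.rescale v (1 + PowerSeries.X))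
  have hW : ∀ v, (HahnSeries.single (-1 : ℤ) (1 : 𝕜) + HahnSeries.C v : LaurentSeries 𝕜)
      = HahnSeries.single (-1 : ℤ) (1 : 𝕜) * W v := by
    intro v
    have h : (HahnSeries.single (-1 : ℤ) (1 : 𝕜) : LaurentSeries 𝕜)
        * HahnSeries.single (1 : ℤ) (1 : 𝕜) = 1 := by
      rw [HahnSeries.single_mul_single]
      simp
    simp only [W, map_add, map_one, PowerSeries.rescale_X, map_mul, HahnSeries.ofPowerSeries_C,
      HahnSeries.ofPowerSeries_X]
    linear_combination (-HahnSeries.C v) * h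
  have hexp : ∀ i : Fin N ⊕ Fin M, HahnSeries.ofPowerSeries ℤ 𝕜
      (PowerSeries.rescale (u i) (PowerSeries.binomialSeries 𝕜 (laxExp n i))) ^ (N - M)
        = (W (u i) ^ (eps i)) ^ n := by
    intro i
    rw [← map_pow, ← map_pow, hpow, Nat.cast_sub hNM.le, laxExp, mul_div_cancel₀ _ hd]
    rcases i with i | i
    · simp only [eps, Sum.elim_inl, W, zpow_one, Int.cast_one, one_mul]
      rw [PowerSeries.binomialSeries_nat, map_pow, map_pow]
    · simp only [eps, Sum.elim_inr, zpow_neg, zpow_one, inv_pow]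
      refine eq_inv_of_mul_eq_one_left ?_
      simp only [W]
      rw [← map_pow, ← map_pow, ← map_mul, ← map_mul,
        ← PowerSeries.binomialSeries_nat (R := ℚ), ← PowerSeries.binomialSeries_add]
      simp
  have hsum : ∑ i : Fin N ⊕ Fin M, eps i = ((N - M : ℕ) : ℤ) := by
    rw [Nat.cast_sub hNM.le]
    simp [eps]
    ring
  have hs0 : (HahnSeries.single (-1 : ℤ) (1 : 𝕜) : LaurentSeries 𝕜) ≠ 0 := by simp
  have hprod : ∏ i : Fin N ⊕ Fin M, (HahnSeries.single (-1 : ℤ) (1 : 𝕜) : LaurentSeries 𝕜) ^ (eps i)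
      = HahnSeries.single (-1 : ℤ) (1 : 𝕜) ^ (N - M) := by
    have hz : ∀ s : Finset (Fin N ⊕ Fin M),
        ∏ i ∈ s, (HahnSeries.single (-1 : ℤ) (1 : 𝕜) : LaurentSeries 𝕜) ^ (eps i)
          = HahnSeries.single (-1 : ℤ) (1 : 𝕜) ^ (∑ i ∈ s, eps i) := by
      intro s
      induction s using Finset.induction_on with
      | empty => simp
      | insert a s ha ih => rw [Finset.prod_insert ha, Finset.sum_insert ha, zpow_add₀ hs0, ih]
    rw [hz, hsum, zpow_natCast]
  have hsn : (HahnSeries.single (-(n : ℤ)) (1 : 𝕜) : LaurentSeries 𝕜)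
      = HahnSeries.single (-1 : ℤ) (1 : 𝕜) ^ n := by
    rw [HahnSeries.single_pow]
    simp
  have hR : ∏ i, (HahnSeries.single (-1 : ℤ) (1 : 𝕜) + HahnSeries.C (u i) : LaurentSeries 𝕜) ^ (eps i)
      = HahnSeries.single (-1 : ℤ) (1 : 𝕜) ^ (N - M) * ∏ i, W (u i) ^ (eps i) := by
    rw [← hprod, ← Finset.prod_mul_distrib]
    exact Finset.prod_congr rfl fun i _ => by rw [hW, mul_zpow]
  rw [hR, laxPow, mul_pow, mul_pow, hsn, ← pow_mul, ← pow_mul, mul_comm n, map_prod,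
    ← Finset.prod_pow, ← Finset.prod_pow]
  exact congrArg _ (Finset.prod_congr rfl fun i _ => hexp i)

end Lax

end RationalLax

end

/-! With `z = 1/p` and `α_i = ε_i n/(N-M)`, the root of the Lax function is `p^n G(z)`, where `G = ∏
(1 + u^i z)^{α_i}` is `genFun`, and the charge is the coefficient `[z^n] G`. Every system in the
statement reduces to one normal form, `u^i_τ = u^i · ∂_x [z^n] (G / (1 + u^i z))`, whose defect is
`flowDefect`. Dividing `G` by `1 + u^i z` lowers the exponent `α_i` by one, which is `dec`.

Explicit equations: `A_i` and `B_ij` are the coefficients of this derivative (`modified_rhs_eq`).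

Hamiltonian form: the matrix `m` is the all-ones matrix minus `(N-M) diag(ε_i)`. Applied to the
vector `u^j ∂_j H`, the all-ones part gives `[z^n] G` by Euler homogeneity, and the diagonal part
removes `u^i [z^n] (z G / (1 + u^i z))` because `ε_i² = 1`. What is left is `[z^n] (G / (1 + u^i
z))` (`sum_mMat_mul_grad`).

Lax form: after division by `L` both sides are sums of simple fractions with poles at `p = -u^i`. On
the bracket side the polynomial part cancels since `ε_i α_j` is symmetric in `i, j`
(`sum_laxNumer_div`). The residue comes from the remainder theorem `(p^n G)_+(-u^i) = [z^n] (G / (1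
+ u^i z))`, differentiated along the field (`laxNumer_neg`). When several roots coincide, only the
sum of their residues is determined. Near points where the pattern of coincidences is locally
constant, coinciding roots have equal defects, and such points meet every nonempty open set, so
continuity finishes the argument (`isLaxFlow_iff`).

Hamiltonian structures: both pairs are operators `c m 𝒟 c` with `m` constant symmetric and `c^i = κ
u^i + μ`; `(κ, μ) = (0, 1)` gives `m 𝒟` and `(1, 0)` gives `(g, Γ)`. For the Jacobi identity, the
variation of a bracket along a third flow splits into second-variation terms, which cancel
cyclically because a second variation is self-adjoint (`isTotalDeriv_evol_varDeriv`), and terms from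
the derivative of `c`, which cancel by symmetry. Degeneracy holds because the vector `ε` spans the
kernel of `m`. -/

noncomputable section

namespace RationalLax

/-! ### Differential functions -/

section DiffFun

set_option linter.unusedSectionVars false

variable {𝕜 : Type*} [RCLike 𝕜] {ι : Type*} [Fintype ι]

/-- Differential functions over `U` that depend on the derivatives of order at most `K`. -/
def IsDiffFunOfOrder (U : Set (ι → 𝕜)) (K : ℕ) (f : (ℕ → ι → 𝕜) → 𝕜) : Prop :=
  ∃ F : (Fin (K + 1) → ι → 𝕜) → 𝕜,
    ContDiffOn 𝕜 ∞ F {b | b 0 ∈ U} ∧ ∀ a : ℕ → ι → 𝕜, a 0 ∈ U → f a = F (fun l => a l)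

variable {U : Set (ι → 𝕜)} {f g : (ℕ → ι → 𝕜) → 𝕜} {K L : ℕ}

theorem isOpen_jets (hU : IsOpen U) (K : ℕ) : IsOpen {b : Fin (K + 1) → ι → 𝕜 | b 0 ∈ U} :=
  hU.preimage (continuous_apply 0)

theorem IsDiffFunOfOrder.mono (h : IsDiffFunOfOrder U K f) (hKL : K ≤ L) :
    IsDiffFunOfOrder U L f := by
  obtain ⟨F, hF, hf⟩ := h
  refine ⟨fun b => F (fun l => b (Fin.castLE (by omega) l)), ?_, fun a ha => by simp [hf a ha]⟩
  refine hF.comp (ContDiff.contDiffOn ?_) fun b hb => ?_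
  · fun_prop
  · simpa using hb

theorem isDiffFun_iff : IsDiffFun U f ↔ ∃ K, IsDiffFunOfOrder U K f := Iff.rfl

theorem IsDiffFunOfOrder.isDiffFun (h : IsDiffFunOfOrder U K f) : IsDiffFun U f := ⟨K, h⟩

theorem IsDiffFunOfOrder.congr (h : IsDiffFunOfOrder U K f) (hfg : ∀ a, a 0 ∈ U → g a = f a) :
    IsDiffFunOfOrder U K g := by
  obtain ⟨F, hF, hf⟩ := h
  exact ⟨F, hF, fun a ha => by rw [hfg a ha, hf a ha]⟩

theorem IsDiffFun.congr (h : IsDiffFun U f) (hfg : ∀ a, a 0 ∈ U → g a = f a) :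
    IsDiffFun U g := by
  obtain ⟨K, h⟩ := h
  exact (IsDiffFunOfOrder.congr h hfg).isDiffFun

theorem IsDiffFun.common_order (hf : IsDiffFun U f) (hg : IsDiffFun U g) :
    ∃ K, IsDiffFunOfOrder U K f ∧ IsDiffFunOfOrder U K g := by
  obtain ⟨K, hf⟩ := hf
  obtain ⟨L, hg⟩ := hg
  exact ⟨max K L, IsDiffFunOfOrder.mono hf (le_max_left _ _),
    IsDiffFunOfOrder.mono hg (le_max_right _ _)⟩

theorem IsDiffFun.add (hf : IsDiffFun U f) (hg : IsDiffFun U g) :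
    IsDiffFun U (fun a => f a + g a) := by
  obtain ⟨K, ⟨F, hF, hf⟩, G, hG, hg⟩ := hf.common_order hg
  exact ⟨K, fun b => F b + G b, hF.add hG, fun a ha => by simp only [hf a ha, hg a ha]⟩

theorem IsDiffFun.mul (hf : IsDiffFun U f) (hg : IsDiffFun U g) :
    IsDiffFun U (fun a => f a * g a) := by
  obtain ⟨K, ⟨F, hF, hf⟩, G, hG, hg⟩ := hf.common_order hg
  exact ⟨K, fun b => F b * G b, hF.mul hG, fun a ha => by simp only [hf a ha, hg a ha]⟩

theorem isDiffFun_const (c : 𝕜) : IsDiffFun U (fun _ : ℕ → ι → 𝕜 => c) :=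
  ⟨0, fun _ => c, contDiffOn_const, fun _ _ => rfl⟩

theorem isDiffFun_coord (k : ℕ) (i : ι) : IsDiffFun U (fun a : ℕ → ι → 𝕜 => a k i) := by
  refine ⟨k, fun b => b (Fin.last k) i, ContDiff.contDiffOn (by fun_prop), fun a _ => by simp⟩

theorem IsDiffFun.const_mul (c : 𝕜) (hf : IsDiffFun U f) : IsDiffFun U (fun a => c * f a) :=
  (isDiffFun_const c).mul hf

theorem IsDiffFun.neg (hf : IsDiffFun U f) : IsDiffFun U (fun a => -f a) :=
  (hf.const_mul (-1)).congr fun a _ => by ring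

theorem IsDiffFun.sub (hf : IsDiffFun U f) (hg : IsDiffFun U g) :
    IsDiffFun U (fun a => f a - g a) :=
  (hf.add hg.neg).congr fun a _ => by ring

theorem IsDiffFun.sum {σ : Type*} (s : Finset σ) {φ : σ → (ℕ → ι → 𝕜) → 𝕜}
    (h : ∀ i ∈ s, IsDiffFun U (φ i)) : IsDiffFun U (fun a => ∑ i ∈ s, φ i a) := by
  classical
  induction s using Finset.induction_on with
  | empty => simpa using isDiffFun_const 0
  | insert i s hi ih =>
    simp only [Finset.sum_insert hi]
    exact (h i (Finset.mem_insert_self _ _)).add (ih fun j hj => h j (Finset.mem_insert_of_mem hj))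

/-! ### Partial derivatives -/

variable [DecidableEq ι]

/-- The curve in the jet space along which `jetPartial` differentiates. -/
abbrev jetLine (a : ℕ → ι → 𝕜) (k : ℕ) (i : ι) (t : 𝕜) : ℕ → ι → 𝕜 :=
  Function.update a k (Function.update (a k) i t)

theorem jetLine_self (a : ℕ → ι → 𝕜) (k : ℕ) (i : ι) : jetLine a k i (a k i) = a := by
  simp [jetLine]

theorem eventually_jetLine_mem (hU : IsOpen U) {a : ℕ → ι → 𝕜} (ha : a 0 ∈ U) (k : ℕ) (i : ι) :
    ∀ᶠ t in nhds (a k i), jetLine a k i t 0 ∈ U := by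
  have hc : Continuous fun t : 𝕜 => jetLine a k i t 0 := by
    rcases Nat.eq_zero_or_pos k with rfl | hk
    · simp only [jetLine, Function.update_self]
      fun_prop
    · simp only [jetLine, Function.update_of_ne hk.ne]
      fun_prop
  refine hc.continuousAt.preimage_mem_nhds (hU.mem_nhds ?_)
  rw [jetLine_self]
  exact ha

theorem jetPartial_congr (hU : IsOpen U) (hfg : ∀ a, a 0 ∈ U → f a = g a) (k : ℕ) (i : ι)
    {a : ℕ → ι → 𝕜} (ha : a 0 ∈ U) : jetPartial k i f a = jetPartial k i g a :=
  Filter.EventuallyEq.deriv_eq <|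
    (eventually_jetLine_mem hU ha k i).mono fun _ ht => hfg _ ht

/-- The line in jet space moves a single coordinate at unit speed, so the chain rule turns
`jetPartial` into a Fréchet derivative of the finite-dimensional representative `F`. Openness of `U`
is needed since `f` agrees with `F` only over `U`. -/
theorem IsDiffFunOfOrder.hasDerivAt_of_le (hU : IsOpen U) {F : (Fin (K + 1) → ι → 𝕜) → 𝕜}
    (hF : ContDiffOn 𝕜 ∞ F {b | b 0 ∈ U}) (hf : ∀ a : ℕ → ι → 𝕜, a 0 ∈ U → f a = F (fun l => a l))
    (k : Fin (K + 1)) (i : ι) {a : ℕ → ι → 𝕜} (ha : a 0 ∈ U) :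
    HasDerivAt (fun t => f (jetLine a k i t))
      (fderiv 𝕜 F (fun l => a l) (Pi.single k (Pi.single i 1))) (a k i) := by
  have hd : HasFDerivAt F (fderiv 𝕜 F (fun l => a l)) (fun l => a l) :=
    ((hF.contDiffAt ((isOpen_jets hU K).mem_nhds (by simpa using ha))).differentiableAt
      (by simp)).hasFDerivAt
  have hline : HasDerivAt (fun (t : 𝕜) (l : Fin (K + 1)) => jetLine a k i t l)
      (Pi.single k (Pi.single i 1)) (a k i) := by
    rw [hasDerivAt_pi]
    intro l
    rw [hasDerivAt_pi]
    intro j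
    by_cases hl : l = k
    · subst hl
      by_cases hj : j = i
      · subst hj
        simpa [jetLine] using hasDerivAt_id' (a l j)
      · simpa [jetLine, hj] using hasDerivAt_const (a l i) (a l j)
    · have hl' : (l : ℕ) ≠ k := fun h => hl (Fin.ext h)
      simpa [jetLine, hl, hl'] using hasDerivAt_const (a k i) (a l j)
  have hd' : HasFDerivAt F (fderiv 𝕜 F (fun l => a l)) (fun l => jetLine a k i (a k i) l) := by
    rw [jetLine_self]; exact hd
  refine (HasFDerivAt.comp_hasDerivAt (a k i) hd' hline).congr_of_eventuallyEq ?_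
  exact (eventually_jetLine_mem hU ha k i).mono fun _ ht => hf _ ht

theorem apply_jetLine_of_lt (h : IsDiffFunOfOrder U K f) {k : ℕ} (hk : K < k)
    (i : ι) {a : ℕ → ι → 𝕜} (ha : a 0 ∈ U) (t : 𝕜) : f (jetLine a k i t) = f a := by
  obtain ⟨F, hF, hf⟩ := h
  have h0 : jetLine a k i t 0 = a 0 := by simp [jetLine, Function.update_of_ne (by omega : 0 ≠ k)]
  rw [hf _ (by rwa [h0]), hf a ha]
  congr 1
  funext l
  simp [jetLine, Function.update_of_ne (by omega : (l : ℕ) ≠ k)]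

theorem IsDiffFunOfOrder.jetPartial_eq_zero (h : IsDiffFunOfOrder U K f) {k : ℕ} (hk : K < k)
    (i : ι) {a : ℕ → ι → 𝕜} (ha : a 0 ∈ U) : jetPartial k i f a = 0 := by
  have : (fun t => f (jetLine a k i t)) = fun _ => f a :=
    funext fun t => apply_jetLine_of_lt h hk i ha t
  simp only [jetPartial]
  rw [show (fun t => f (Function.update a k (Function.update (a k) i t))) = fun _ => f a from this]
  simp

theorem IsDiffFun.hasDerivAt_jetLine (hU : IsOpen U) (h : IsDiffFun U f) (k : ℕ) (i : ι)
    {a : ℕ → ι → 𝕜} (ha : a 0 ∈ U) :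
    HasDerivAt (fun t => f (jetLine a k i t)) (jetPartial k i f a) (a k i) := by
  obtain ⟨K, h⟩ := h
  obtain ⟨F, hF, hf⟩ := IsDiffFunOfOrder.mono h (le_max_left K k)
  exact (IsDiffFunOfOrder.hasDerivAt_of_le hU hF hf ⟨k, by omega⟩ i ha).differentiableAt.hasDerivAt

theorem IsDiffFunOfOrder.jetPartial (hU : IsOpen U) (h : IsDiffFunOfOrder U K f) (k : ℕ) (i : ι) :
    IsDiffFunOfOrder U K (jetPartial k i f) := by
  by_cases hk : k ≤ K
  · obtain ⟨F, hF, hf⟩ := h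
    refine ⟨fun b => fderiv 𝕜 F b (Pi.single ⟨k, by omega⟩ (Pi.single i 1)), ?_, fun a ha => ?_⟩
    · exact (hF.fderiv_of_isOpen (isOpen_jets hU K) (by simp)).clm_apply contDiffOn_const
    · exact (IsDiffFunOfOrder.hasDerivAt_of_le hU hF hf ⟨k, by omega⟩ i ha).deriv
  · exact ⟨fun _ => 0, contDiffOn_const,
      fun a ha => h.jetPartial_eq_zero (by omega) i ha⟩

theorem IsDiffFun.jetPartial (hU : IsOpen U) (h : IsDiffFun U f) (k : ℕ) (i : ι) :
    IsDiffFun U (jetPartial k i f) := by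
  obtain ⟨K, h⟩ := h
  exact (IsDiffFunOfOrder.jetPartial hU h k i).isDiffFun

theorem jetPartial_comm (hU : IsOpen U) (h : IsDiffFun U f) (k l : ℕ) (i j : ι)
    {a : ℕ → ι → 𝕜} (ha : a 0 ∈ U) :
    jetPartial k i (jetPartial l j f) a = jetPartial l j (jetPartial k i f) a := by
  obtain ⟨K₀, h⟩ := h
  -- The order is raised until both jet variables are coordinates of one finite-dimensional space;
  -- symmetry of the second derivative of `F` then applies.
  obtain ⟨K, hk, hl, F, hF, hf⟩ : ∃ K, k ≤ K ∧ l ≤ K ∧ IsDiffFunOfOrder U K f :=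
    ⟨max K₀ (max k l), by omega, by omega, IsDiffFunOfOrder.mono h (le_max_left K₀ (max k l))⟩
  have hopen := isOpen_jets hU K
  have key : ∀ (p q : Fin (K + 1)) (i j : ι), jetPartial p i (jetPartial q j f) a
      = fderiv 𝕜 (fderiv 𝕜 F) (fun l => a l) (Pi.single p (Pi.single i 1))
        (Pi.single q (Pi.single j 1)) := by
    intro p q i j
    have h1 : ∀ a : ℕ → ι → 𝕜, a 0 ∈ U → jetPartial q j f a
        = fderiv 𝕜 F (fun l => a l) (Pi.single q (Pi.single j 1)) :=
      fun a ha => (IsDiffFunOfOrder.hasDerivAt_of_le hU hF hf q j ha).deriv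
    have hF' : ContDiffOn 𝕜 ∞ (fderiv 𝕜 F) {b | b 0 ∈ U} :=
      hF.fderiv_of_isOpen hopen (by simp)
    have h2 : ContDiffOn 𝕜 ∞ (fun b => fderiv 𝕜 F b (Pi.single q (Pi.single j 1))) {b | b 0 ∈ U} :=
      hF'.clm_apply contDiffOn_const
    have h3 := (IsDiffFunOfOrder.hasDerivAt_of_le hU h2 h1 p i ha).deriv
    have hd : DifferentiableAt 𝕜 (fderiv 𝕜 F) (fun l => a l) :=
      (hF'.contDiffAt (hopen.mem_nhds (by simpa using ha))).differentiableAt (by simp)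
    rw [fderiv_clm_apply hd (differentiableAt_const _)] at h3
    simpa [RationalLax.jetPartial] using h3
  have hsymm : IsSymmSndFDerivAt 𝕜 F (fun l : Fin (K + 1) => a l) :=
    (hF.contDiffAt (hopen.mem_nhds (by simpa using ha))).isSymmSndFDerivAt (by
      rw [minSmoothness_of_isRCLikeNormedField]; exact WithTop.coe_le_coe.2 (le_top : (2 : ℕ∞) ≤ ⊤))
  have e1 := key ⟨k, by omega⟩ ⟨l, by omega⟩ i j
  have e2 := key ⟨l, by omega⟩ ⟨k, by omega⟩ j i
  simp only at e1 e2
  rw [e1, e2]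
  exact hsymm _ _

theorem jetPartial_add (hU : IsOpen U) (hf : IsDiffFun U f) (hg : IsDiffFun U g) (k : ℕ) (i : ι)
    {a : ℕ → ι → 𝕜} (ha : a 0 ∈ U) :
    jetPartial k i (fun a => f a + g a) a = jetPartial k i f a + jetPartial k i g a :=
  ((hf.hasDerivAt_jetLine hU k i ha).add (hg.hasDerivAt_jetLine hU k i ha)).deriv

theorem jetPartial_mul (hU : IsOpen U) (hf : IsDiffFun U f) (hg : IsDiffFun U g) (k : ℕ) (i : ι)
    {a : ℕ → ι → 𝕜} (ha : a 0 ∈ U) :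
    jetPartial k i (fun a => f a * g a) a = jetPartial k i f a * g a + f a * jetPartial k i g a := by
  have := ((hf.hasDerivAt_jetLine hU k i ha).mul (hg.hasDerivAt_jetLine hU k i ha)).deriv
  rw [jetLine_self] at this
  exact this

theorem jetPartial_const (c : 𝕜) (k : ℕ) (i : ι) (a : ℕ → ι → 𝕜) :
    jetPartial k i (fun _ => c) a = 0 := by
  simp [jetPartial]

theorem jetPartial_coord (k l : ℕ) (i j : ι) (a : ℕ → ι → 𝕜) :
    jetPartial k i (fun a => a l j) a = if k = l ∧ i = j then 1 else 0 := by
  simp only [jetPartial]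
  split_ifs with h
  · obtain ⟨rfl, rfl⟩ := h
    simp
  · by_cases hk : k = l
    · subst hk
      have : j ≠ i := fun h' => h ⟨rfl, h'.symm⟩
      simp [this]
    · simp [Function.update_of_ne (Ne.symm hk)]

theorem jetPartial_of_zeroth_order (φ : (ι → 𝕜) → 𝕜) (i : ι) (a : ℕ → ι → 𝕜) :
    jetPartial 0 i (fun a => φ (a 0)) a = coordPartial i φ (a 0) := by
  simp [jetPartial, coordPartial]

end DiffFun

/-! ### Vector fields on the jet space -/

section VectorField

set_option linter.unusedSectionVars false

variable {𝕜 : Type*} [RCLike 𝕜] {ι : Type*} [Fintype ι] [DecidableEq ι]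

/-- The derivative of `f` along the vector field `∑_{k,i} V^i_{(k)} ∂/∂u^i_{(k)}` on the jet space. -/
def lieD (V : (ℕ → ι → 𝕜) → ℕ → ι → 𝕜) (f : (ℕ → ι → 𝕜) → 𝕜) (a : ℕ → ι → 𝕜) : 𝕜 :=
  ∑ᶠ k : ℕ, ∑ i : ι, V a k i * jetPartial k i f a

/-- All components of a vector field on the jet space are differential functions. -/
def IsDiffField (U : Set (ι → 𝕜)) (V : (ℕ → ι → 𝕜) → ℕ → ι → 𝕜) : Prop :=
  ∀ k i, IsDiffFun U fun a => V a k i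

variable {U : Set (ι → 𝕜)} {f g : (ℕ → ι → 𝕜) → 𝕜} {K : ℕ} {V W : (ℕ → ι → 𝕜) → ℕ → ι → 𝕜}
  {a : ℕ → ι → 𝕜}

theorem lieD_eq_sum (V : (ℕ → ι → 𝕜) → ℕ → ι → 𝕜) (h : IsDiffFunOfOrder U K f) (ha : a 0 ∈ U) :
    lieD V f a = ∑ k ∈ Finset.range (K + 1), ∑ i, V a k i * jetPartial k i f a := by
  refine finsum_eq_sum_of_support_subset _ fun k hk => ?_
  by_contra hK
  refine hk (Finset.sum_eq_zero fun i _ => ?_)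
  rw [h.jetPartial_eq_zero (by simpa using hK) i ha, mul_zero]

theorem lieD_congr (hU : IsOpen U) (hfg : ∀ a, a 0 ∈ U → f a = g a) (ha : a 0 ∈ U) :
    lieD V f a = lieD V g a := by
  simp only [lieD, jetPartial_congr hU hfg _ _ ha]

theorem lieD_const (c : 𝕜) : lieD V (fun _ => c) a = 0 := by
  simp [lieD, jetPartial_const]

theorem lieD_coord (k : ℕ) (i : ι) : lieD V (fun a => a k i) a = V a k i := by
  rw [lieD, finsum_eq_single _ k]
  · simp [jetPartial_coord]
  · intro l hl
    simp [jetPartial_coord, hl]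

theorem lieD_add (hU : IsOpen U) (hf : IsDiffFun U f) (hg : IsDiffFun U g) (ha : a 0 ∈ U) :
    lieD V (fun a => f a + g a) a = lieD V f a + lieD V g a := by
  obtain ⟨K, hK⟩ := hf.add hg
  obtain ⟨L, hL, hL'⟩ := hf.common_order hg
  rw [lieD_eq_sum V (IsDiffFunOfOrder.mono hK (le_max_left K L)) ha,
    lieD_eq_sum V (hL.mono (le_max_right K L)) ha, lieD_eq_sum V (hL'.mono (le_max_right K L)) ha]
  simp only [← Finset.sum_add_distrib]
  refine Finset.sum_congr rfl fun k _ => Finset.sum_congr rfl fun i _ => ?_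
  rw [jetPartial_add hU hf hg k i ha, mul_add]

theorem lieD_mul (hU : IsOpen U) (hf : IsDiffFun U f) (hg : IsDiffFun U g) (ha : a 0 ∈ U) :
    lieD V (fun a => f a * g a) a = lieD V f a * g a + f a * lieD V g a := by
  obtain ⟨K, hK⟩ := hf.mul hg
  obtain ⟨L, hL, hL'⟩ := hf.common_order hg
  rw [lieD_eq_sum V (IsDiffFunOfOrder.mono hK (le_max_left K L)) ha,
    lieD_eq_sum V (hL.mono (le_max_right K L)) ha, lieD_eq_sum V (hL'.mono (le_max_right K L)) ha]
  simp only [Finset.sum_mul, Finset.mul_sum, ← Finset.sum_add_distrib]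
  refine Finset.sum_congr rfl fun k _ => Finset.sum_congr rfl fun i _ => ?_
  rw [jetPartial_mul hU hf hg k i ha]
  ring

theorem lieD_const_mul (hU : IsOpen U) (c : 𝕜) (hf : IsDiffFun U f) (ha : a 0 ∈ U) :
    lieD V (fun a => c * f a) a = c * lieD V f a := by
  rw [lieD_mul hU (isDiffFun_const c) hf ha, lieD_const, zero_mul, zero_add]

theorem lieD_sub (hU : IsOpen U) (hf : IsDiffFun U f) (hg : IsDiffFun U g) (ha : a 0 ∈ U) :
    lieD V (fun a => f a - g a) a = lieD V f a - lieD V g a := by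
  have h : ∀ a : ℕ → ι → 𝕜, a 0 ∈ U → f a - g a = f a + (-1) * g a := fun a _ => by ring
  rw [lieD_congr hU h ha, lieD_add hU hf (hg.const_mul _) ha, lieD_const_mul hU _ hg ha]
  ring

theorem lieD_sum (hU : IsOpen U) {σ : Type*} (s : Finset σ) {φ : σ → (ℕ → ι → 𝕜) → 𝕜}
    (h : ∀ i ∈ s, IsDiffFun U (φ i)) (ha : a 0 ∈ U) :
    lieD V (fun a => ∑ i ∈ s, φ i a) a = ∑ i ∈ s, lieD V (φ i) a := by
  classical
  induction s using Finset.induction_on with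
  | empty => simpa using lieD_const 0
  | insert i s hi ih =>
    have hs : ∀ j ∈ s, IsDiffFun U (φ j) := fun j hj => h j (Finset.mem_insert_of_mem hj)
    simp only [Finset.sum_insert hi]
    rw [lieD_add hU (h i (Finset.mem_insert_self _ _)) (IsDiffFun.sum s hs) ha, ih hs]

theorem IsDiffFun.lieD (hU : IsOpen U) (hV : IsDiffField U V) (hf : IsDiffFun U f) :
    IsDiffFun U (lieD V f) := by
  obtain ⟨K, hK⟩ := isDiffFun_iff.1 hf
  refine IsDiffFun.congr (f := fun a => ∑ k ∈ Finset.range (K + 1), ∑ i, V a k i * RationalLax.jetPartial k i f a)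
    ?_ fun a ha => lieD_eq_sum V hK ha
  exact IsDiffFun.sum _ fun k _ => IsDiffFun.sum _ fun i _ => (hV k i).mul (hf.jetPartial hU k i)

/-- The commutator of two vector fields on the jet space. -/
theorem lieD_lieD_sub (hU : IsOpen U) (hV : IsDiffField U V) (hW : IsDiffField U W)
    (hf : IsDiffFun U f) (ha : a 0 ∈ U) :
    lieD V (lieD W f) a - lieD W (lieD V f) a
      = lieD (fun a k i => lieD V (fun b => W b k i) a - lieD W (fun b => V b k i) a) f a := by
  obtain ⟨K, hK⟩ := isDiffFun_iff.1 hf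
  -- The Leibniz rule splits the composition into a first-order part and a second-order part; the
  -- latter is symmetric in `V` and `W` (`hswap`), so it drops out of the commutator.
  have key : ∀ V W : (ℕ → ι → 𝕜) → ℕ → ι → 𝕜, IsDiffField U W →
      lieD V (lieD W f) a = ∑ k ∈ Finset.range (K + 1), ∑ i,
        lieD V (fun b => W b k i) a * jetPartial k i f a
        + ∑ k ∈ Finset.range (K + 1), ∑ i, ∑ l ∈ Finset.range (K + 1), ∑ j,
          W a k i * V a l j * jetPartial l j (jetPartial k i f) a := by
    intro V W hW
    have hterm : ∀ k i, IsDiffFun U fun a => W a k i * jetPartial k i f a :=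
      fun k i => (hW k i).mul (hf.jetPartial hU k i)
    rw [lieD_congr hU (fun a ha => lieD_eq_sum W hK ha) ha,
      lieD_sum hU _ (fun k _ => IsDiffFun.sum _ fun i _ => hterm k i) ha, ← Finset.sum_add_distrib]
    refine Finset.sum_congr rfl fun k _ => ?_
    rw [lieD_sum hU _ (fun i _ => hterm k i) ha, ← Finset.sum_add_distrib]
    refine Finset.sum_congr rfl fun i _ => ?_
    rw [lieD_mul hU (hW k i) (hf.jetPartial hU k i) ha, lieD_eq_sum V (hK.jetPartial hU k i) ha]
    simp only [Finset.mul_sum, mul_assoc]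
  rw [key V W hW, key W V hV, lieD_eq_sum _ hK ha]
  have hswap : ∑ k ∈ Finset.range (K + 1), ∑ i, ∑ l ∈ Finset.range (K + 1), ∑ j,
        W a k i * V a l j * jetPartial l j (jetPartial k i f) a
      = ∑ k ∈ Finset.range (K + 1), ∑ i, ∑ l ∈ Finset.range (K + 1), ∑ j,
        V a k i * W a l j * jetPartial l j (jetPartial k i f) a := by
    rw [Finset.sum_congr rfl fun k _ => Finset.sum_comm, Finset.sum_comm]
    refine Finset.sum_congr rfl fun k _ => ?_
    rw [Finset.sum_congr rfl fun l _ => Finset.sum_comm, Finset.sum_comm]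
    refine Finset.sum_congr rfl fun i _ => Finset.sum_congr rfl fun l _ =>
      Finset.sum_congr rfl fun j _ => ?_
    rw [jetPartial_comm hU hf k l i j ha]
    ring
  rw [hswap]
  simp only [sub_mul, Finset.sum_sub_distrib]
  ring

/-! ### The total derivative and evolutionary vector fields -/

/-- Treating `𝒟` as the Lie derivative along the shift field lets it inherit the rules for `lieD`,
the commutator formula included. -/
theorem totalD_eq_lieD : (totalD : ((ℕ → ι → 𝕜) → 𝕜) → (ℕ → ι → 𝕜) → 𝕜)
    = lieD fun a k i => a (k + 1) i := rfl

theorem isDiffField_shift : IsDiffField U fun (a : ℕ → ι → 𝕜) k i => a (k + 1) i :=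
  fun k i => isDiffFun_coord (k + 1) i

theorem totalD_congr (hU : IsOpen U) (hfg : ∀ a, a 0 ∈ U → f a = g a) (ha : a 0 ∈ U) :
    totalD f a = totalD g a :=
  lieD_congr (V := fun a k i => a (k + 1) i) hU hfg ha

theorem totalD_const (c : 𝕜) : totalD (fun _ => c) a = 0 :=
  lieD_const (V := fun a k i => a (k + 1) i) c

theorem totalD_add (hU : IsOpen U) (hf : IsDiffFun U f) (hg : IsDiffFun U g) (ha : a 0 ∈ U) :
    totalD (fun a => f a + g a) a = totalD f a + totalD g a :=
  lieD_add (V := fun a k i => a (k + 1) i) hU hf hg ha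

theorem totalD_sub (hU : IsOpen U) (hf : IsDiffFun U f) (hg : IsDiffFun U g) (ha : a 0 ∈ U) :
    totalD (fun a => f a - g a) a = totalD f a - totalD g a :=
  lieD_sub (V := fun a k i => a (k + 1) i) hU hf hg ha

theorem totalD_mul (hU : IsOpen U) (hf : IsDiffFun U f) (hg : IsDiffFun U g) (ha : a 0 ∈ U) :
    totalD (fun a => f a * g a) a = totalD f a * g a + f a * totalD g a :=
  lieD_mul (V := fun a k i => a (k + 1) i) hU hf hg ha

theorem totalD_const_mul (hU : IsOpen U) (c : 𝕜) (hf : IsDiffFun U f) (ha : a 0 ∈ U) :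
    totalD (fun a => c * f a) a = c * totalD f a :=
  lieD_const_mul (V := fun a k i => a (k + 1) i) hU c hf ha

theorem IsDiffFun.totalD (hU : IsOpen U) (hf : IsDiffFun U f) : IsDiffFun U (totalD f) :=
  hf.lieD hU isDiffField_shift

theorem IsDiffFun.iterate_totalD (hU : IsOpen U) (hf : IsDiffFun U f) (k : ℕ) :
    IsDiffFun U (RationalLax.totalD^[k] f) := by
  induction k with
  | zero => exact hf
  | succ k ih => rw [Function.iterate_succ_apply']; exact ih.totalD hU

theorem iterate_totalD_congr (hU : IsOpen U) (hfg : ∀ a, a 0 ∈ U → f a = g a) (k : ℕ) :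
    ∀ a, a 0 ∈ U → totalD^[k] f a = totalD^[k] g a := by
  induction k with
  | zero => exact hfg
  | succ k ih =>
    intro a ha
    rw [Function.iterate_succ_apply', Function.iterate_succ_apply']
    exact totalD_congr hU ih ha

/-- The derivative along the evolutionary vector field with characteristic `Q`, i.e. the derivative
along the flow `u^i_τ = Q^i`. -/
def evol (Q : ι → (ℕ → ι → 𝕜) → 𝕜) : ((ℕ → ι → 𝕜) → 𝕜) → (ℕ → ι → 𝕜) → 𝕜 :=
  lieD fun a k i => totalD^[k] (Q i) a

variable {Q R : ι → (ℕ → ι → 𝕜) → 𝕜}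

theorem isDiffField_evol (hU : IsOpen U) (hQ : ∀ i, IsDiffFun U (Q i)) :
    IsDiffField U fun a k i => totalD^[k] (Q i) a :=
  fun k i => (hQ i).iterate_totalD hU k

theorem IsDiffFun.evol (hU : IsOpen U) (hQ : ∀ i, IsDiffFun U (Q i)) (hf : IsDiffFun U f) :
    IsDiffFun U (evol Q f) :=
  hf.lieD hU (isDiffField_evol hU hQ)

/-- The commutator of the two vector fields has components `𝒟^{k+1} Q^i - 𝒟 (𝒟^k Q^i) = 0`. -/
theorem evol_totalD (hU : IsOpen U) (hQ : ∀ i, IsDiffFun U (Q i)) (hf : IsDiffFun U f)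
    (ha : a 0 ∈ U) : evol Q (totalD f) a = totalD (evol Q f) a := by
  have h := lieD_lieD_sub hU (isDiffField_evol hU hQ) isDiffField_shift hf ha
  rw [← sub_eq_zero]
  refine h.trans ?_
  simp only [lieD_coord]
  simp only [← totalD_eq_lieD, ← Function.iterate_succ_apply' totalD]
  simp [lieD]

theorem evol_iterate_totalD (hU : IsOpen U) (hQ : ∀ i, IsDiffFun U (Q i)) (hf : IsDiffFun U f)
    (k : ℕ) : ∀ a, a 0 ∈ U → evol Q (totalD^[k] f) a = totalD^[k] (evol Q f) a := by
  induction k with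
  | zero => exact fun a _ => rfl
  | succ k ih =>
    intro a ha
    rw [Function.iterate_succ_apply', Function.iterate_succ_apply',
      evol_totalD hU hQ (hf.iterate_totalD hU k) ha]
    exact totalD_congr hU ih ha

theorem iterate_totalD_sub (hU : IsOpen U) (hf : IsDiffFun U f) (hg : IsDiffFun U g) (k : ℕ) :
    ∀ a, a 0 ∈ U → totalD^[k] (fun a => f a - g a) a = totalD^[k] f a - totalD^[k] g a := by
  induction k with
  | zero => exact fun a _ => rfl
  | succ k ih =>
    intro a ha
    simp only [Function.iterate_succ_apply']
    exact (totalD_congr hU ih ha).trans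
      (totalD_sub hU (hf.iterate_totalD hU k) (hg.iterate_totalD hU k) ha)

/-- Both fields commute with `𝒟`, so the components of their commutator are the `𝒟^k` of its zeroth
components: it is again evolutionary. -/
theorem evol_evol_sub (hU : IsOpen U) (hQ : ∀ i, IsDiffFun U (Q i)) (hR : ∀ i, IsDiffFun U (R i))
    (hf : IsDiffFun U f) (ha : a 0 ∈ U) :
    evol R (evol Q f) a - evol Q (evol R f) a
      = evol (fun i a => evol R (Q i) a - evol Q (R i) a) f a := by
  refine (lieD_lieD_sub hU (isDiffField_evol hU hR) (isDiffField_evol hU hQ) hf ha).trans ?_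
  simp only [evol, lieD]
  refine finsum_congr fun k => Finset.sum_congr rfl fun i _ => ?_
  congr 1
  have h := iterate_totalD_sub hU ((hQ i).evol hU hR) ((hR i).evol hU hQ) k a ha
  rw [← evol_iterate_totalD hU hR (hQ i) k a ha, ← evol_iterate_totalD hU hQ (hR i) k a ha] at h
  exact h.symm

/-! ### Integration by parts -/

theorem IsTotalDeriv.congr (h : IsTotalDeriv U f) (hfg : ∀ a, a 0 ∈ U → g a = f a) :
    IsTotalDeriv U g := by
  obtain ⟨p, hp, h⟩ := h
  exact ⟨p, hp, fun a ha => by rw [hfg a ha, h a ha]⟩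

theorem IsTotalDeriv.add (hU : IsOpen U) (hf : IsTotalDeriv U f) (hg : IsTotalDeriv U g) :
    IsTotalDeriv U (fun a => f a + g a) := by
  obtain ⟨p, hp, hf⟩ := hf
  obtain ⟨q, hq, hg⟩ := hg
  exact ⟨_, hp.add hq, fun a ha => by simp only [hf a ha, hg a ha]; exact (totalD_add hU hp hq ha).symm⟩

theorem IsTotalDeriv.const_mul (hU : IsOpen U) (c : 𝕜) (hf : IsTotalDeriv U f) :
    IsTotalDeriv U (fun a => c * f a) := by
  obtain ⟨p, hp, hf⟩ := hf
  exact ⟨_, hp.const_mul c, fun a ha => by simp only [hf a ha]; exact (totalD_const_mul hU c hp ha).symm⟩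

theorem IsTotalDeriv.sub (hU : IsOpen U) (hf : IsTotalDeriv U f) (hg : IsTotalDeriv U g) :
    IsTotalDeriv U (fun a => f a - g a) :=
  (hf.add hU (hg.const_mul hU (-1))).congr fun a _ => by ring

theorem isTotalDeriv_zero : IsTotalDeriv U (fun _ : ℕ → ι → 𝕜 => (0 : 𝕜)) :=
  ⟨fun _ => 0, isDiffFun_const 0, fun _ _ => (totalD_const 0).symm⟩

theorem IsTotalDeriv.sum (hU : IsOpen U) {σ : Type*} (s : Finset σ) {φ : σ → (ℕ → ι → 𝕜) → 𝕜}
    (h : ∀ i ∈ s, IsTotalDeriv U (φ i)) : IsTotalDeriv U (fun a => ∑ i ∈ s, φ i a) := by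
  classical
  induction s using Finset.induction_on with
  | empty => simpa using isTotalDeriv_zero
  | insert i s hi ih =>
    simp only [Finset.sum_insert hi]
    exact (h i (Finset.mem_insert_self _ _)).add hU
      (ih fun j hj => h j (Finset.mem_insert_of_mem hj))

theorem IsTotalDeriv.evol (hU : IsOpen U) (hQ : ∀ i, IsDiffFun U (Q i)) (hf : IsTotalDeriv U f) :
    IsTotalDeriv U (evol Q f) := by
  obtain ⟨p, hp, hf⟩ := hf
  exact ⟨_, hp.evol hU hQ, fun a ha => (lieD_congr hU hf ha).trans (evol_totalD hU hQ hp ha)⟩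

theorem isTotalDeriv_mul_totalD (hU : IsOpen U) (hf : IsDiffFun U f) (hg : IsDiffFun U g) :
    IsTotalDeriv U (fun a => totalD f a * g a + f a * totalD g a) :=
  ⟨_, hf.mul hg, fun _ ha => (totalD_mul hU hf hg ha).symm⟩

theorem isTotalDeriv_iterate_totalD (hU : IsOpen U) (hf : IsDiffFun U f) (hg : IsDiffFun U g)
    (k : ℕ) : IsTotalDeriv U
      (fun a => totalD^[k] f a * g a - f a * ((-1) ^ k * totalD^[k] g a)) := by
  induction k generalizing g with
  | zero => exact isTotalDeriv_zero.congr fun a _ => by simp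
  | succ k ih =>
    -- One `𝒟` is moved from `𝒟^k f` onto `g`, and the induction hypothesis is used for `𝒟 g`; hence
    -- the generalization over `g`.
    refine ((isTotalDeriv_mul_totalD hU (hf.iterate_totalD hU k) hg).sub hU
      (ih (hg.totalD hU))).congr fun a _ => ?_
    rw [Function.iterate_succ_apply' totalD k f, Function.iterate_succ_apply totalD k g]
    ring

theorem varDeriv_eq_sum (hU : IsOpen U) (h : IsDiffFunOfOrder U K f) (i : ι) (ha : a 0 ∈ U) :
    varDeriv f i a = ∑ k ∈ Finset.range (K + 1), (-1) ^ k * totalD^[k] (jetPartial k i f) a := by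
  refine finsum_eq_sum_of_support_subset _ fun k hk => ?_
  by_contra hK
  refine hk ?_
  have h0 : ∀ a : ℕ → ι → 𝕜, a 0 ∈ U → jetPartial k i f a = (fun _ => 0) a :=
    fun a ha => h.jetPartial_eq_zero (by simpa using hK) i ha
  have hz : ∀ k, totalD^[k] (fun _ : ℕ → ι → 𝕜 => (0 : 𝕜)) = fun _ => 0 := fun k =>
    Function.iterate_fixed (funext fun a => totalD_const 0) k
  simp only [iterate_totalD_congr hU h0 k a ha, hz, mul_zero]

theorem IsDiffFun.varDeriv (hU : IsOpen U) (hf : IsDiffFun U f) (i : ι) :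
    IsDiffFun U (varDeriv f i) := by
  obtain ⟨K, hK⟩ := isDiffFun_iff.1 hf
  refine IsDiffFun.congr (IsDiffFun.sum (Finset.range (K + 1)) fun k _ => ?_)
    fun a ha => varDeriv_eq_sum hU hK i ha
  exact ((hf.jetPartial hU k i).iterate_totalD hU k).const_mul _

/-- Integration by parts: the variation of `∫ f dx` along the flow `u_τ = Q` is `∫ Q · δf/δu dx`. -/
theorem isTotalDeriv_evol_sub (hU : IsOpen U) (hQ : ∀ i, IsDiffFun U (Q i)) (hf : IsDiffFun U f) :
    IsTotalDeriv U (fun a => evol Q f a - ∑ i, Q i a * varDeriv f i a) := by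
  obtain ⟨K, hK⟩ := isDiffFun_iff.1 hf
  refine IsTotalDeriv.congr (IsTotalDeriv.sum hU (Finset.range (K + 1)) fun k _ =>
    IsTotalDeriv.sum hU Finset.univ fun i _ =>
      isTotalDeriv_iterate_totalD hU (hQ i) (hf.jetPartial hU k i) k) fun a ha => ?_
  rw [evol, lieD_eq_sum _ hK ha]
  simp only [varDeriv_eq_sum hU hK _ ha, Finset.mul_sum, Finset.sum_sub_distrib]
  congr 1
  exact Finset.sum_comm

/-- The Fréchet derivative of a variational derivative is formally self-adjoint. -/
theorem isTotalDeriv_evol_varDeriv (hU : IsOpen U) (hQ : ∀ i, IsDiffFun U (Q i))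
    (hR : ∀ i, IsDiffFun U (R i)) (hf : IsDiffFun U f) :
    IsTotalDeriv U (fun a => ∑ i, Q i a * evol R (varDeriv f i) a
      - ∑ i, R i a * evol Q (varDeriv f i) a) := by
  -- The first-variation formula for `Q` is varied along `R`. Antisymmetrizing in `Q` and `R` leaves
  -- the commutator, whose own first variation (`hcomm`) absorbs the terms in which the
  -- characteristics are differentiated.
  have hprod : ∀ {Q R : ι → (ℕ → ι → 𝕜) → 𝕜}, (∀ i, IsDiffFun U (Q i)) →
      (∀ i, IsDiffFun U (R i)) → IsTotalDeriv U (fun a => evol R (evol Q f) a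
        - ∑ i, (evol R (Q i) a * varDeriv f i a + Q i a * evol R (varDeriv f i) a)) := by
    intro Q R hQ hR
    have hterm : ∀ i, IsDiffFun U fun a => Q i a * varDeriv f i a :=
      fun i => (hQ i).mul (hf.varDeriv hU i)
    refine ((isTotalDeriv_evol_sub hU hQ hf).evol hU hR).congr fun a ha => ?_
    refine Eq.symm ((lieD_sub hU (hf.evol hU hQ) (IsDiffFun.sum _ fun i _ => hterm i) ha).trans ?_)
    rw [lieD_sum hU _ (fun i _ => hterm i) ha]
    congr 1
    exact Finset.sum_congr rfl fun i _ => lieD_mul hU (hQ i) (hf.varDeriv hU i) ha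
  have hcomm := isTotalDeriv_evol_sub hU
    (fun i => ((hQ i).evol hU hR).sub ((hR i).evol hU hQ)) hf
  refine ((hcomm.sub hU (hprod hQ hR)).add hU (hprod hR hQ)).congr fun a ha => ?_
  rw [← evol_evol_sub hU hQ hR hf ha]
  simp only [Finset.sum_add_distrib, sub_mul, Finset.sum_sub_distrib]
  ring

end VectorField

/-! ### Hamiltonian operators `c(u) m 𝒟 c(u)` with affine `c` -/

section AffineOperator

set_option linter.unusedSectionVars false

variable {𝕜 : Type*} [RCLike 𝕜] {ι : Type*} [Fintype ι] [DecidableEq ι]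
  {U : Set (ι → 𝕜)} {f h : (ℕ → ι → 𝕜) → 𝕜} {a : ℕ → ι → 𝕜} {m : Matrix ι ι 𝕜} {κ μ : 𝕜}
  {g : (ι → 𝕜) → Matrix ι ι 𝕜} {Γ : (ι → 𝕜) → ι → ι → ι → 𝕜}

/-- The factor `c^i(u) = κ u^i + μ` as a differential function. -/
def affCoord (κ μ : 𝕜) (i : ι) (a : ℕ → ι → 𝕜) : 𝕜 := κ * a 0 i + μ

/-- `c^i δI/δu^i` for `I = ∫ f dx`. -/
def affMom (κ μ : 𝕜) (f : (ℕ → ι → 𝕜) → 𝕜) (i : ι) (a : ℕ → ι → 𝕜) : 𝕜 :=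
  affCoord κ μ i a * varDeriv f i a

/-- `∑_j m^{ij} 𝒟 (c^j δI/δu^j)` for `I = ∫ f dx`. -/
def affVel (m : Matrix ι ι 𝕜) (κ μ : 𝕜) (f : (ℕ → ι → 𝕜) → 𝕜) (i : ι) (a : ℕ → ι → 𝕜) : 𝕜 :=
  ∑ j, m i j * totalD (affMom κ μ f j) a

/-- The Hamiltonian vector field `c^i ∑_j m^{ij} 𝒟 (c^j δI/δu^j)` of `I = ∫ f dx`. -/
def affHam (m : Matrix ι ι 𝕜) (κ μ : 𝕜) (f : (ℕ → ι → 𝕜) → 𝕜) (i : ι) (a : ℕ → ι → 𝕜) : 𝕜 :=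
  affCoord κ μ i a * affVel m κ μ f i a

theorem isDiffFun_affCoord (κ μ : 𝕜) (i : ι) : IsDiffFun U (affCoord κ μ i) :=
  ((isDiffFun_coord 0 i).const_mul κ).add (isDiffFun_const μ)

theorem IsDiffFun.affMom (hU : IsOpen U) (hf : IsDiffFun U f) (i : ι) :
    IsDiffFun U (affMom κ μ f i) :=
  (isDiffFun_affCoord κ μ i).mul (hf.varDeriv hU i)

theorem IsDiffFun.affVel (hU : IsOpen U) (hf : IsDiffFun U f) (i : ι) :
    IsDiffFun U (affVel m κ μ f i) :=
  IsDiffFun.sum _ fun j _ => ((hf.affMom hU j).totalD hU).const_mul _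

theorem IsDiffFun.affHam (hU : IsOpen U) (hf : IsDiffFun U f) (i : ι) :
    IsDiffFun U (affHam m κ μ f i) :=
  (isDiffFun_affCoord κ μ i).mul (hf.affVel hU i)

theorem lieD_affCoord (hU : IsOpen U) (V : (ℕ → ι → 𝕜) → ℕ → ι → 𝕜) (i : ι) (ha : a 0 ∈ U) :
    lieD V (affCoord κ μ i) a = κ * V a 0 i := by
  unfold affCoord
  rw [lieD_add hU ((isDiffFun_coord 0 i).const_mul κ) (isDiffFun_const μ) ha, lieD_const,
    lieD_const_mul hU κ (isDiffFun_coord 0 i) ha, lieD_coord, add_zero]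

/-- The hydrodynamic operator with `g^{ij} = m^{ij} c^i c^j` and `Γ^{ij}_k = δ^j_k κ m^{ij} c^i` is
the composition `c m 𝒟 c`. -/
theorem hydroOp_affine (hU : IsOpen U)
    (hg : ∀ u i j, g u i j = m i j * (κ * u i + μ) * (κ * u j + μ))
    (hΓ : ∀ u i j k, Γ u i j k = if j = k then m i j * (κ * u i + μ) * κ else 0)
    {q : ι → (ℕ → ι → 𝕜) → 𝕜} (hq : ∀ i, IsDiffFun U (q i)) (i : ι) (ha : a 0 ∈ U) :
    hydroOp g Γ q i a
      = affCoord κ μ i a * ∑ j, m i j * totalD (fun a => affCoord κ μ j a * q j a) a := by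
  simp only [hydroOp, Finset.mul_sum]
  refine Finset.sum_congr rfl fun j _ => ?_
  rw [totalD_mul hU (isDiffFun_affCoord κ μ j) (hq j) ha, totalD_eq_lieD, lieD_affCoord hU _ j ha,
    hg]
  simp only [hΓ, ite_mul, zero_mul, Finset.sum_ite_eq, Finset.mem_univ, if_true, affCoord]
  ring

theorem hydroBracket_affine (hU : IsOpen U)
    (hg : ∀ u i j, g u i j = m i j * (κ * u i + μ) * (κ * u j + μ))
    (hΓ : ∀ u i j k, Γ u i j k = if j = k then m i j * (κ * u i + μ) * κ else 0)
    (hh : IsDiffFun U h) (ha : a 0 ∈ U) :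
    hydroBracket g Γ f h a = ∑ i, affMom κ μ f i a * affVel m κ μ h i a := by
  refine Finset.sum_congr rfl fun i _ => ?_
  rw [hydroOp_affine hU hg hΓ (hh.varDeriv hU) i ha]
  simp only [affMom, affVel]
  exact mul_left_comm _ _ _ |>.trans (mul_assoc _ _ _).symm

theorem sum_mul_affVel (p : ι → 𝕜) :
    ∑ i, p i * affVel m κ μ h i a = ∑ i, ∑ j, m i j * (p i * totalD (affMom κ μ h j) a) := by
  simp only [affVel, Finset.mul_sum]
  exact Finset.sum_congr rfl fun i _ => Finset.sum_congr rfl fun j _ => by ring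

/-- The variation of the bracket of two functionals along a flow. -/
theorem isTotalDeriv_evol_bracket (hU : IsOpen U) (hm : ∀ i j, m i j = m j i)
    {Q : ι → (ℕ → ι → 𝕜) → 𝕜} (hQ : ∀ i, IsDiffFun U (Q i)) (hf : IsDiffFun U f)
    (hh : IsDiffFun U h) :
    IsTotalDeriv U (fun a => evol Q (fun a => ∑ i, affMom κ μ f i a * affVel m κ μ h i a) a
      - (∑ i, evol Q (affMom κ μ f i) a * affVel m κ μ h i a
        - ∑ i, evol Q (affMom κ μ h i) a * affVel m κ μ f i a)) := by
  have hE : ∀ j, IsDiffFun U (evol Q (affMom κ μ h j)) := fun j => (hh.affMom hU j).evol hU hQ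
  -- In the half of the Leibniz rule that varies the velocity of `h`, integration by parts moves `𝒟`
  -- onto the momentum of `f`, and the symmetry of `m` reassembles the velocity of `f` with a minus
  -- sign.
  refine IsTotalDeriv.congr (IsTotalDeriv.sum hU Finset.univ fun i _ =>
    IsTotalDeriv.sum hU Finset.univ fun j _ => (isTotalDeriv_mul_totalD hU
      (hf.affMom hU (κ := κ) (μ := μ) i) (hE j)).const_mul hU (m i j)) fun a ha => ?_
  have h1 : evol Q (fun a => ∑ i, affMom κ μ f i a * affVel m κ μ h i a) a
      = ∑ i, (evol Q (affMom κ μ f i) a * affVel m κ μ h i a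
        + affMom κ μ f i a * ∑ j, m i j * totalD (evol Q (affMom κ μ h j)) a) := by
    refine (lieD_sum hU _ (fun i _ => (hf.affMom hU i).mul (hh.affVel hU i)) ha).trans
      (Finset.sum_congr rfl fun i _ => (lieD_mul hU (hf.affMom hU i) (hh.affVel hU i) ha).trans ?_)
    congr 2
    refine (lieD_sum hU _ (fun j _ => ((hh.affMom hU j).totalD hU).const_mul _) ha).trans
      (Finset.sum_congr rfl fun j _ => ?_)
    rw [← evol_totalD hU hQ (hh.affMom hU j) ha]
    exact lieD_const_mul hU _ ((hh.affMom hU j).totalD hU) ha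
  have h2 : ∑ i, evol Q (affMom κ μ h i) a * affVel m κ μ f i a
      = ∑ i, ∑ j, m i j * (totalD (affMom κ μ f i) a * evol Q (affMom κ μ h j) a) := by
    rw [sum_mul_affVel, Finset.sum_comm]
    refine Finset.sum_congr rfl fun i _ => Finset.sum_congr rfl fun j _ => ?_
    rw [hm j i]
    ring
  rw [h1, h2]
  simp only [Finset.sum_add_distrib, Finset.mul_sum, mul_add]
  simp only [mul_left_comm]
  ring

/-- The constant symmetric matrix `m` and the affine functions `c^i` give the Hamiltonian operator
`c m 𝒟 c`. -/
theorem isHamiltonianStructure_affine (hU : IsOpen U) (hm : ∀ i j, m i j = m j i)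
    (hg : ∀ u i j, g u i j = m i j * (κ * u i + μ) * (κ * u j + μ))
    (hΓ : ∀ u i j k, Γ u i j k = if j = k then m i j * (κ * u i + μ) * κ else 0) :
    IsHamiltonianStructure U g Γ where
  smooth_g i j := by
    simp only [hg]
    exact ContDiff.contDiffOn (by fun_prop)
  smooth_Γ i j k := by
    simp only [hΓ]
    split_ifs
    · exact ContDiff.contDiffOn (by fun_prop)
    · exact contDiffOn_const
  skew f h hf hh := by
    -- The symmetrized bracket is `∑ m^{ij} 𝒟 (p_i q_j)`, with `p` and `q` the momenta of the two
    -- functionals.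
    refine IsTotalDeriv.congr (IsTotalDeriv.sum hU Finset.univ fun i _ =>
      IsTotalDeriv.sum hU Finset.univ fun j _ => (isTotalDeriv_mul_totalD hU
        (hf.affMom hU (κ := κ) (μ := μ) i) (hh.affMom hU (κ := κ) (μ := μ) j)).const_mul hU (m i j))
      fun a ha => ?_
    rw [hydroBracket_affine hU hg hΓ hh ha, hydroBracket_affine hU hg hΓ hf ha, sum_mul_affVel,
      sum_mul_affVel]
    simp only [mul_add, Finset.sum_add_distrib]
    rw [add_comm]
    congr 1
    rw [Finset.sum_comm]
    refine Finset.sum_congr rfl fun i _ => Finset.sum_congr rfl fun j _ => ?_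
    rw [hm j i]
    ring
  jacobi f₁ f₂ f₃ h₁ h₂ h₃ := by
    -- Varying the momentum `c^i δf/δu^i` along the flow of `k` gives `S` when the variational
    -- derivative is hit and `T` when `c^i` is hit. Both are symmetric in the last two arguments:
    -- `T` exactly, `S` modulo total derivatives.
    let S (f h k : (ℕ → ι → 𝕜) → 𝕜) (a : ℕ → ι → 𝕜) : 𝕜 :=
      ∑ i, affHam m κ μ h i a * evol (affHam m κ μ k) (varDeriv f i) a
    let T (f h k : (ℕ → ι → 𝕜) → 𝕜) (a : ℕ → ι → 𝕜) : 𝕜 :=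
      ∑ i, κ * (affMom κ μ f i a * affVel m κ μ h i a * affVel m κ μ k i a)
    have hT : ∀ f h k a, T f h k a = T f k h a := fun f h k a =>
      Finset.sum_congr rfl fun i _ => by ring
    have hS : ∀ {f h k}, IsDiffFun U f → IsDiffFun U h → IsDiffFun U k →
        IsTotalDeriv U fun a => S f h k a - S f k h a := fun hf hh hk =>
      isTotalDeriv_evol_varDeriv hU (hh.affHam hU) (hk.affHam hU) hf
    have key : ∀ {f h k}, IsDiffFun U f → IsDiffFun U h → IsDiffFun U k →
        IsTotalDeriv U fun a => hydroBracket g Γ (hydroBracket g Γ f h) k a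
          - (T f h k a + S f h k a - (T h f k a + S h f k a)) := by
      intro f h k hf hh hk
      have hQ : ∀ i, IsDiffFun U (affHam m κ μ k i) := hk.affHam hU
      have hb : IsDiffFun U (hydroBracket g Γ f h) :=
        (IsDiffFun.sum Finset.univ fun i _ => (hf.affMom hU i).mul (hh.affVel hU i)).congr
          fun a ha => hydroBracket_affine hU hg hΓ hh ha
      have hE : ∀ {f}, IsDiffFun U f → ∀ h a, a 0 ∈ U →
          ∑ i, evol (affHam m κ μ k) (affMom κ μ f i) a * affVel m κ μ h i a
            = T f h k a + S f h k a := by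
        intro f hf h a ha
        simp only [S, T, ← Finset.sum_add_distrib]
        refine Finset.sum_congr rfl fun i _ => ?_
        have : evol (affHam m κ μ k) (affMom κ μ f i) a
            = κ * affHam m κ μ k i a * varDeriv f i a
              + affCoord κ μ i a * evol (affHam m κ μ k) (varDeriv f i) a := by
          refine (lieD_mul hU (isDiffFun_affCoord κ μ i) (hf.varDeriv hU i) ha).trans ?_
          rw [lieD_affCoord hU _ i ha]
          rfl
        rw [this]
        simp only [affHam, affMom]
        ring
      refine ((isTotalDeriv_evol_bracket hU hm hQ hf hh (κ := κ) (μ := μ)).sub hU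
        (isTotalDeriv_evol_sub hU hQ hb)).congr fun a ha => ?_
      have hEb : evol (affHam m κ μ k) (hydroBracket g Γ f h) a = evol (affHam m κ μ k)
          (fun a => ∑ i, affMom κ μ f i a * affVel m κ μ h i a) a :=
        lieD_congr hU (fun a ha => hydroBracket_affine hU hg hΓ hh ha) ha
      have hB : hydroBracket g Γ (hydroBracket g Γ f h) k a
          = ∑ i, affHam m κ μ k i a * varDeriv (hydroBracket g Γ f h) i a := by
        refine Finset.sum_congr rfl fun i _ => ?_
        rw [hydroOp_affine hU hg hΓ (hk.varDeriv hU) i ha, mul_comm]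
        rfl
      rw [hEb, hB, hE hf h a ha, hE hh f a ha]
      ring
    -- In the cyclic sum the six `S` terms and the six `T` terms each pair off into differences that
    -- swap the last two arguments.
    refine ((((key h₁ h₂ h₃).add hU (key h₂ h₃ h₁)).add hU (key h₃ h₁ h₂)).add hU
      (((hS h₁ h₂ h₃).add hU (hS h₂ h₃ h₁)).add hU (hS h₃ h₁ h₂))).congr fun a ha => ?_
    rw [hT f₁ f₃ f₂, hT f₂ f₁ f₃, hT f₃ f₂ f₁]
    ring

end AffineOperator

/-! ### The generating function `∏ (1 + u^i z)^{α_i}` -/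

section GenFun

open PowerSeries hiding binomialSeries

set_option linter.unusedSectionVars false

variable {𝕜 : Type*} [RCLike 𝕜] {ι : Type*} [Fintype ι] [DecidableEq ι]

/-- The power series `∏_i (1 + u^i z)^{α_i}`. -/
def genFun (α : ι → ℚ) (u : ι → 𝕜) : PowerSeries 𝕜 :=
  ∏ i, rescale (u i) (PowerSeries.binomialSeries 𝕜 (α i))

/-- Lower the `j`-th exponent by one. -/
def dec (α : ι → ℚ) (j : ι) : ι → ℚ := Function.update α j (α j - 1)

/-- The derivative of the coefficient of `z^k` of `∏_i (1 + u^i z)^{α_i}` in the direction `v`. -/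
def genDeriv (α : ι → ℚ) (k : ℕ) (u v : ι → 𝕜) : 𝕜 :=
  ∑ j, (α j : 𝕜) * v j * coeff k (X * genFun (dec α j) u)

theorem coeff_rescale_binomialSeries (c : 𝕜) (r : ℚ) (k : ℕ) :
    coeff k (rescale c (PowerSeries.binomialSeries 𝕜 r)) = ((Ring.choose r k : ℚ) : 𝕜) * c ^ k := by
  rw [coeff_rescale, binomialSeries_coeff, Rat.smul_def, mul_one, mul_comm]

theorem sum_finsuppAntidiag_univ {A : Type*} [AddCommMonoid A] (n : ℕ) (F : (ι → ℕ) → A) :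
    ∑ l ∈ Finset.finsuppAntidiag Finset.univ n, F l = ∑ r ∈ Finset.piAntidiag Finset.univ n, F r := by
  refine Finset.sum_bij' (fun l _ => (l : ι → ℕ)) (fun r _ => Finsupp.equivFunOnFinite.symm r)
    ?_ ?_ ?_ ?_ ?_
  · intro l hl
    simpa using hl
  · intro r hr
    simpa using hr
  · intro l _
    ext
    simp
  · intro r _
    simp
  · intro l _
    rfl

theorem coeff_prod_eq_sum_piAntidiag (F : ι → PowerSeries 𝕜) (n : ℕ) :
    coeff n (∏ i, F i) = ∑ r ∈ Finset.piAntidiag Finset.univ n, ∏ i, coeff (r i) (F i) := by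
  rw [coeff_prod]
  exact sum_finsuppAntidiag_univ n fun r => ∏ i, coeff (r i) (F i)

theorem coeff_genFun (α : ι → ℚ) (u : ι → 𝕜) (n : ℕ) :
    coeff n (genFun α u)
      = ∑ r ∈ Finset.piAntidiag Finset.univ n, ∏ i, ((Ring.choose (α i) (r i) : ℚ) : 𝕜) * u i ^ r i := by
  simp only [genFun, coeff_prod_eq_sum_piAntidiag, coeff_rescale_binomialSeries]

theorem genFun_eq_mul_prod_erase (α : ι → ℚ) (u : ι → 𝕜) (j : ι) :
    genFun α u = rescale (u j) (PowerSeries.binomialSeries 𝕜 (α j))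
      * ∏ i ∈ Finset.univ.erase j, rescale (u i) (PowerSeries.binomialSeries 𝕜 (α i)) :=
  (Finset.mul_prod_erase _ _ (Finset.mem_univ j)).symm

theorem genFun_dec (α : ι → ℚ) (u : ι → 𝕜) (j : ι) :
    genFun (dec α j) u = rescale (u j) (PowerSeries.binomialSeries 𝕜 (α j - 1))
      * ∏ i ∈ Finset.univ.erase j, rescale (u i) (PowerSeries.binomialSeries 𝕜 (α i)) := by
  rw [genFun_eq_mul_prod_erase _ _ j]
  congr 1
  · simp [dec]
  · refine Finset.prod_congr rfl fun i hi => ?_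
    simp [dec, Finset.ne_of_mem_erase hi]

/-- This is `(1 + z)^r = (1 + z) (1 + z)^{r-1}` in one factor, and it justifies reading `dec α j` as
division by `1 + u^j z`. -/
theorem genFun_eq_mul_dec (α : ι → ℚ) (u : ι → 𝕜) (j : ι) :
    genFun α u = (1 + C (u j) * X) * genFun (dec α j) u := by
  have h : PowerSeries.binomialSeries 𝕜 (α j) = (1 + X) * PowerSeries.binomialSeries 𝕜 (α j - 1) := by
    have h1 := binomialSeries_add (A := 𝕜) (1 : ℚ) (α j - 1)
    have h2 := binomialSeries_nat (A := 𝕜) (R := ℚ) 1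
    rw [Nat.cast_one, pow_one] at h2
    rw [← h2, ← h1]
    congr 1
    ring
  rw [genFun_dec, genFun_eq_mul_prod_erase _ _ j, h, map_mul, mul_assoc]
  simp [rescale_X]

theorem coeff_genFun_eq (α : ι → ℚ) (u : ι → 𝕜) (j : ι) (k : ℕ) :
    coeff k (genFun α u)
      = coeff k (genFun (dec α j) u) + u j * coeff k (X * genFun (dec α j) u) := by
  rw [genFun_eq_mul_dec α u j, add_mul, one_mul, mul_assoc, map_add, coeff_C_mul]

theorem contDiff_coeff_genFun (α : ι → ℚ) (k : ℕ) :
    ContDiff 𝕜 ∞ fun u : ι → 𝕜 => coeff k (genFun α u) := by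
  simp only [coeff_genFun]
  fun_prop

/-! ### Differentiation along curves -/

section Curve

variable {𝕂 : Type*} [NontriviallyNormedField 𝕂] [NormedAlgebra 𝕂 𝕜] {t : 𝕂}

/-- A curve of power series has the derivative `F'` at `t`, coefficient by coefficient. -/
def HasCoeffDerivAt (F : 𝕂 → PowerSeries 𝕜) (F' : PowerSeries 𝕜) (t : 𝕂) : Prop :=
  ∀ k, HasDerivAt (fun s => coeff k (F s)) (coeff k F') t

theorem HasCoeffDerivAt.mul {F G : 𝕂 → PowerSeries 𝕜} {F' G' : PowerSeries 𝕜}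
    (hF : HasCoeffDerivAt F F' t) (hG : HasCoeffDerivAt G G' t) :
    HasCoeffDerivAt (fun s => F s * G s) (F' * G t + F t * G') t := by
  intro k
  simp only [map_add, coeff_mul, ← Finset.sum_add_distrib]
  exact HasDerivAt.fun_sum fun p _ => (hF p.1).mul (hG p.2)

theorem hasCoeffDerivAt_prod (s : Finset ι) {F : ι → 𝕂 → PowerSeries 𝕜} {F' : ι → PowerSeries 𝕜}
    (h : ∀ i ∈ s, HasCoeffDerivAt (F i) (F' i) t) :
    HasCoeffDerivAt (fun s' => ∏ i ∈ s, F i s') (∑ j ∈ s, F' j * ∏ i ∈ s.erase j, F i t) t := by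
  induction s using Finset.induction_on with
  | empty =>
    intro k
    simpa using hasDerivAt_const t (coeff k (1 : PowerSeries 𝕜))
  | insert i s hi ih =>
    simp only [Finset.prod_insert hi, Finset.sum_insert hi, Finset.erase_insert hi]
    convert (h i (Finset.mem_insert_self _ _)).mul
      (ih fun j hj => h j (Finset.mem_insert_of_mem hj)) using 2
    rw [Finset.mul_sum]
    refine Finset.sum_congr rfl fun j hj => ?_
    rw [Finset.erase_insert_of_ne (by rintro rfl; exact hi hj),
      Finset.prod_insert (fun h => hi (Finset.mem_of_mem_erase h))]
    ring

theorem hasCoeffDerivAt_rescale_binomialSeries {c : 𝕂 → 𝕜} {c' : 𝕜} (hc : HasDerivAt c c' t)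
    (r : ℚ) : HasCoeffDerivAt (fun s => rescale (c s) (PowerSeries.binomialSeries 𝕜 r))
      (C ((r : 𝕜) * c') * X * rescale (c t) (PowerSeries.binomialSeries 𝕜 (r - 1))) t := by
  intro k
  simp only [coeff_rescale_binomialSeries]
  rw [mul_assoc, coeff_C_mul]
  rcases k with _ | k
  · simpa using hasDerivAt_const t (1 : 𝕜)
  · rw [coeff_succ_X_mul, coeff_rescale_binomialSeries]
    have h := (hc.pow (k + 1)).const_mul ((Ring.choose r (k + 1) : ℚ) : 𝕜)
    -- The absorption identity for binomial coefficients is the coefficient form of `d(1 + cz)^r = r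
    -- z (1 + cz)^{r-1} dc`.
    have hch : (k + 1 : ℚ) * Ring.choose r (k + 1) = r * Ring.choose (r - 1) k := by
      have := Ring.choose_smul_choose r (n := k + 1) (k := 1) (by omega)
      simpa [Ring.choose_one_right, nsmul_eq_mul] using this
    have hch' : ((k + 1 : 𝕜)) * ((Ring.choose r (k + 1) : ℚ) : 𝕜)
        = (r : 𝕜) * ((Ring.choose (r - 1) k : ℚ) : 𝕜) := by exact_mod_cast hch
    refine h.congr_deriv ?_
    simp only [Nat.add_sub_cancel]
    push_cast
    linear_combination (c t ^ k * c') * hch'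

/-- Each factor contributes its logarithmic derivative `α_j u'_j z / (1 + u^j z)`. The parameter
field `𝕂` is kept general to cover both the real variables `x, τ` and the coordinates in `𝕜`. -/
theorem hasCoeffDerivAt_genFun {u : 𝕂 → ι → 𝕜} {u' : ι → 𝕜}
    (hu : ∀ i, HasDerivAt (fun s => u s i) (u' i) t) (α : ι → ℚ) :
    HasCoeffDerivAt (fun s => genFun α (u s))
      (∑ j, C ((α j : 𝕜) * u' j) * (X * genFun (dec α j) (u t))) t := by
  have h : (∑ j, C ((α j : 𝕜) * u' j) * (X * genFun (dec α j) (u t)) : PowerSeries 𝕜)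
      = ∑ j, C ((α j : 𝕜) * u' j) * X
          * rescale (u t j) (PowerSeries.binomialSeries 𝕜 (α j - 1))
          * ∏ i ∈ Finset.univ.erase j, rescale (u t i) (PowerSeries.binomialSeries 𝕜 (α i)) :=
    Finset.sum_congr rfl fun j _ => by rw [genFun_dec]; ring
  rw [h]
  exact hasCoeffDerivAt_prod Finset.univ
    (fun i _ => hasCoeffDerivAt_rescale_binomialSeries (hu i) (α i))

theorem hasDerivAt_coeff_genFun {u : 𝕂 → ι → 𝕜} {u' : ι → 𝕜}
    (hu : ∀ i, HasDerivAt (fun s => u s i) (u' i) t) (α : ι → ℚ) (k : ℕ) :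
    HasDerivAt (fun s => coeff k (genFun α (u s))) (genDeriv α k (u t) u') t := by
  convert hasCoeffDerivAt_genFun hu α k using 1
  simp only [genDeriv, map_sum, coeff_C_mul]

end Curve

/-- The coefficient of `z^k` is homogeneous of degree `k` in `u`. -/
theorem genDeriv_self (α : ι → ℚ) (k : ℕ) (u : ι → 𝕜) :
    genDeriv α k u u = k * coeff k (genFun α u) := by
  -- Euler's argument: the dilation `s ↦ s u` is differentiated at `s = 1` in two ways.
  have h1 : HasDerivAt (fun s : 𝕜 => coeff k (genFun α (fun i => s * u i)))
      (genDeriv α k (fun i => 1 * u i) u) 1 :=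
    hasDerivAt_coeff_genFun (t := (1 : 𝕜)) (u := fun s i => s * u i)
      (fun i => by simpa using (hasDerivAt_id' (1 : 𝕜)).mul_const (u i)) α k
  have h2 : ∀ s : 𝕜, coeff k (genFun α (fun i => s * u i)) = s ^ k * coeff k (genFun α u) := by
    intro s
    rw [← coeff_rescale]
    congr 1
    simp only [genFun, map_prod, rescale_rescale]
    exact Finset.prod_congr rfl fun i _ => by rw [mul_comm]
  simp only [one_mul, h2] at h1
  have h3 := (hasDerivAt_pow k (1 : 𝕜)).mul_const (coeff k (genFun α u))
  simpa using h1.unique h3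

end GenFun

/-! ### Densities that do not depend on derivatives -/

section Zeroth

set_option linter.unusedSectionVars false

variable {𝕜 : Type*} [RCLike 𝕜] {ι : Type*} [Fintype ι] [DecidableEq ι]

theorem isDiffFunOfOrder_zero {φ : (ι → 𝕜) → 𝕜} (hφ : ContDiff 𝕜 ∞ φ) :
    IsDiffFunOfOrder Set.univ 0 (fun a : ℕ → ι → 𝕜 => φ (a 0)) :=
  ⟨fun b => φ (b 0), ContDiff.contDiffOn (by fun_prop), fun a _ => by simp⟩

theorem totalD_zeroth {φ : (ι → 𝕜) → 𝕜} (hφ : ContDiff 𝕜 ∞ φ) (a : ℕ → ι → 𝕜) :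
    totalD (fun a => φ (a 0)) a = ∑ i, a 1 i * coordPartial i φ (a 0) := by
  rw [totalD_eq_lieD, lieD_eq_sum _ (isDiffFunOfOrder_zero hφ) (Set.mem_univ _)]
  simp [jetPartial_of_zeroth_order]

theorem varDeriv_zeroth {φ : (ι → 𝕜) → 𝕜} (hφ : ContDiff 𝕜 ∞ φ) (i : ι) (a : ℕ → ι → 𝕜) :
    varDeriv (fun a => φ (a 0)) i a = coordPartial i φ (a 0) := by
  rw [varDeriv_eq_sum isOpen_univ (isDiffFunOfOrder_zero hφ) i (Set.mem_univ _)]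
  simp [jetPartial_of_zeroth_order]

/-- A linear combination, with constant coefficients, of total derivatives. -/
theorem sum_mul_totalD (c : ι → 𝕜) {q : ι → (ℕ → ι → 𝕜) → 𝕜}
    (hq : ∀ j, IsDiffFun Set.univ (q j)) (a : ℕ → ι → 𝕜) :
    ∑ j, c j * totalD (q j) a = totalD (fun a => ∑ j, c j * q j a) a := by
  rw [totalD_eq_lieD, lieD_sum isOpen_univ _ (fun j _ => (hq j).const_mul (c j)) (Set.mem_univ _)]
  exact Finset.sum_congr rfl fun j _ =>
    (lieD_const_mul isOpen_univ (c j) (hq j) (Set.mem_univ _)).symm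

theorem hasDerivAt_update_apply (u : ι → 𝕜) (j i : ι) (t : 𝕜) :
    HasDerivAt (fun s => Function.update u j s i) ((Pi.single j 1 : ι → 𝕜) i) t := by
  by_cases h : i = j
  · subst h
    simpa using hasDerivAt_id' t
  · simpa [h] using hasDerivAt_const t (u i)

theorem contDiff_exp : ContDiff 𝕜 ∞ (NormedSpace.exp : 𝕜 → 𝕜) :=
  contDiff_iff_contDiffAt.2 fun x => (NormedSpace.exp_analytic (𝕂 := 𝕜) x).contDiffAt

theorem exp_ne_zero (x : 𝕜) : NormedSpace.exp x ≠ 0 :=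
  letI : NormedAlgebra ℚ 𝕜 := NormedAlgebra.restrictScalars ℚ ℝ 𝕜
  (NormedSpace.isUnit_exp x).ne_zero

theorem genDeriv_single (α : ι → ℚ) (k : ℕ) (u : ι → 𝕜) (j : ι) (c : 𝕜) :
    genDeriv α k u (Pi.single j c)
      = (α j : 𝕜) * c * PowerSeries.coeff k (PowerSeries.X * genFun (dec α j) u) := by
  rw [genDeriv, Finset.sum_eq_single j]
  · simp
  · intro i _ hi
    simp [hi]
  · simp

theorem coordPartial_coeff_genFun (α : ι → ℚ) (k : ℕ) (j : ι) (u : ι → 𝕜) :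
    coordPartial j (fun u => PowerSeries.coeff k (genFun α u)) u
      = (α j : 𝕜) * PowerSeries.coeff k (PowerSeries.X * genFun (dec α j) u) := by
  have h := (hasDerivAt_coeff_genFun (fun i => hasDerivAt_update_apply u j i (u j)) α k).deriv
  rw [Function.update_eq_self, genDeriv_single, mul_one] at h
  exact h

theorem coordPartial_coeff_genFun_exp (α : ι → ℚ) (k : ℕ) (j : ι) (w : ι → 𝕜) :
    coordPartial j (fun w => PowerSeries.coeff k (genFun α fun i => NormedSpace.exp (w i))) w
      = (α j : 𝕜) * NormedSpace.exp (w j)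
        * PowerSeries.coeff k (PowerSeries.X * genFun (dec α j) fun i => NormedSpace.exp (w i)) := by
  have hd : ∀ i, HasDerivAt (fun s => NormedSpace.exp (Function.update w j s i))
      ((Pi.single j (NormedSpace.exp (w j)) : ι → 𝕜) i) (w j) := by
    intro i
    have := (hasDerivAt_exp (x := Function.update w j (w j) i)).comp (w j)
      (hasDerivAt_update_apply w j i (w j))
    refine this.congr_deriv ?_
    by_cases h : i = j
    · subst h
      simp
    · simp [h]
  have h := (hasDerivAt_coeff_genFun hd α k).deriv
  simp only [Function.update_eq_self, genDeriv_single] at h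
  exact h

theorem contDiff_coeff_genFun_exp (α : ι → ℚ) (k : ℕ) :
    ContDiff 𝕜 ∞ fun w : ι → 𝕜 => PowerSeries.coeff k (genFun α fun i => NormedSpace.exp (w i)) :=
  (contDiff_coeff_genFun α k).comp
    (contDiff_pi.2 fun i => contDiff_exp.comp (contDiff_apply 𝕜 𝕜 i))

end Zeroth

/-! ### The conserved densities and the evolution equations -/

section Flows

open PowerSeries hiding binomialSeries

variable {𝕜 : Type*} [RCLike 𝕜] {N M : ℕ}

/-- The Laurent variable is `1/p`, so `p^k` has exponent `-k`, and the prefactor `p^n` shifts it to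
`z^{n-k}`. -/
theorem laxPow_coeff_neg (n : ℕ) (u : Fin N ⊕ Fin M → 𝕜) {k : ℕ} (hk : k ≤ n) :
    (laxPow n u).coeff (-(k : ℤ)) = coeff (n - k) (genFun (laxExp n) u) := by
  rw [laxPow, HahnSeries.coeff_single_mul, one_mul,
    show -(k : ℤ) - -(n : ℤ) = ((n - k : ℕ) : ℤ) by omega, HahnSeries.ofPowerSeries_apply_coeff]
  rfl

theorem charge_eq_coeff (n : ℕ) (u : Fin N ⊕ Fin M → 𝕜) :
    charge n u = coeff n (genFun (laxExp n) u) := by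
  simpa [charge] using laxPow_coeff_neg n u (Nat.zero_le n)

theorem binom_natCast (a : ℚ) (b : ℕ) : binom a b = Ring.choose a b := by
  simp [binom]

theorem charge_eq_chargeSum (n : ℕ) (u : Fin N ⊕ Fin M → 𝕜) : charge n u = chargeSum n u := by
  simp only [charge_eq_coeff, coeff_genFun, chargeSum, binom_natCast]

theorem flowB_eq (n : ℕ) {i j : Fin N ⊕ Fin M} (hij : j ≠ i) (u : Fin N ⊕ Fin M → 𝕜) :
    flowB n i j u
      = (laxExp n j : 𝕜) * coeff (n - 1) (genFun (dec (dec (laxExp n) i) j) u) := by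
  rw [flowB, coeff_genFun]
  congr 1
  refine Finset.sum_congr rfl fun r _ => ?_
  rw [← Finset.mul_prod_erase _ _ (Finset.mem_univ i),
    ← Finset.mul_prod_erase _ _ (Finset.mem_erase.2 ⟨hij, Finset.mem_univ j⟩)]
  have hprod : ∏ k ∈ (Finset.univ.erase i).erase j,
      ((Ring.choose (dec (dec (laxExp n) i) j k) (r k) : ℚ) : 𝕜) * u k ^ r k
        = ∏ k ∈ (Finset.univ.erase i).erase j,
          ((binom (laxExp n k) (r k) : ℚ) : 𝕜) * u k ^ r k := by
    refine Finset.prod_congr rfl fun k hk => ?_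
    have hk1 := Finset.ne_of_mem_erase hk
    have hk2 := Finset.ne_of_mem_erase (Finset.mem_of_mem_erase hk)
    simp [dec, hk1, hk2, binom_natCast]
  rw [hprod]
  simp only [dec, binom_natCast, Function.update_self, Function.update_of_ne hij,
    Function.update_of_ne hij.symm]
  ring

/-- The shifted lower index `r_i - 1` encodes a factor `u^i z` in front of `(1 + u^i z)^{α_i - 2}`.
-/
theorem flowA_eq (n : ℕ) (i : Fin N ⊕ Fin M) (u : Fin N ⊕ Fin M → 𝕜) :
    flowA n i u = ((laxExp n i - 1 : ℚ) : 𝕜)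
      * (u i * coeff n (X * genFun (dec (dec (laxExp n) i) i) u)) := by
  let F : Fin N ⊕ Fin M → PowerSeries 𝕜 := Function.update
    (fun k => rescale (u k) (PowerSeries.binomialSeries 𝕜 (laxExp n k))) i
    (C (u i) * (X * rescale (u i) (PowerSeries.binomialSeries 𝕜 (laxExp n i - 2))))
  have hF : C (u i) * (X * genFun (dec (dec (laxExp n) i) i) u) = ∏ k, F k := by
    rw [genFun_dec, ← Finset.mul_prod_erase _ _ (Finset.mem_univ i)]
    have hprod : ∏ k ∈ Finset.univ.erase i, F k = ∏ k ∈ Finset.univ.erase i,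
        rescale (u k) (PowerSeries.binomialSeries 𝕜 (dec (laxExp n) i k)) :=
      Finset.prod_congr rfl fun k hk => by simp [F, dec, Finset.ne_of_mem_erase hk]
    rw [hprod]
    simp only [F, dec, Function.update_self, mul_assoc]
    rw [show laxExp n i - 1 - 1 = laxExp n i - 2 by ring]
  have hFi : ∀ r : ℕ, coeff r (F i)
      = ((binom (laxExp n i - 2) ((r : ℤ) - 1) : ℚ) : 𝕜) * u i ^ r := by
    intro r
    simp only [F, Function.update_self, coeff_C_mul]
    -- At `r = 0` the lower index is `-1`: the convention that `binom` vanishes there matches the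
    -- missing constant term.
    rcases r with _ | r
    · simp [binom]
    · rw [coeff_succ_X_mul, coeff_rescale_binomialSeries, Nat.cast_succ, add_sub_cancel_right,
        binom_natCast]
      ring
  rw [flowA, ← coeff_C_mul, hF, coeff_prod_eq_sum_piAntidiag]
  congr 1
  refine Finset.sum_congr rfl fun r _ => ?_
  rw [← Finset.prod_erase_mul _ _ (Finset.mem_univ i), hFi]
  congr 1
  refine Finset.prod_congr rfl fun k hk => ?_
  simp only [F, Function.update_of_ne (Finset.ne_of_mem_erase hk), coeff_rescale_binomialSeries,
    binom_natCast]

/-- The right-hand side of the evolution equations is `u^i` times the derivative of the coefficient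
of `z^n` in `(1 + u^i z)⁻¹ ∏_k (1 + u^k z)^{ε_k n/(N-M)}`. -/
theorem modified_rhs_eq {n : ℕ} (hn : 1 ≤ n) (i : Fin N ⊕ Fin M) (u v : Fin N ⊕ Fin M → 𝕜) :
    flowA n i u * v i + ∑ j ∈ Finset.univ.erase i, u i * flowB n i j u * v j
      = u i * genDeriv (dec (laxExp n) i) n u v := by
  obtain ⟨n, rfl⟩ : ∃ k, n = k + 1 := ⟨n - 1, by omega⟩
  rw [genDeriv, ← Finset.add_sum_erase _ _ (Finset.mem_univ i), mul_add, flowA_eq, Finset.mul_sum]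
  congr 1
  · simp only [dec, Function.update_self]
    ring
  · refine Finset.sum_congr rfl fun j hj => ?_
    rw [flowB_eq _ (Finset.ne_of_mem_erase hj), coeff_succ_X_mul, Nat.add_sub_cancel]
    have : dec (laxExp (n + 1)) i j = laxExp (n + 1) j := by
      simp [dec, Finset.ne_of_mem_erase hj]
    rw [this]
    ring

/-! ### The action of the matrix `m` on gradients -/

theorem laxExp_eq (n : ℕ) (i : Fin N ⊕ Fin M) :
    ((laxExp n i : ℚ) : 𝕜) = ((eps i : ℤ) : 𝕜) * n / ((N : 𝕜) - M) := by
  simp [laxExp]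

theorem eps_mul_self (i : Fin N ⊕ Fin M) : ((eps i : ℤ) : 𝕜) * ((eps i : ℤ) : 𝕜) = 1 := by
  rcases i with i | i <;> simp [eps]

theorem sub_ne_zero_of_lt (𝕜 : Type*) [RCLike 𝕜] (hNM : M < N) : (N : 𝕜) - M ≠ 0 :=
  sub_ne_zero.2 (by exact_mod_cast hNM.ne')

theorem mMat_symm (i j : Fin N ⊕ Fin M) : mMat 𝕜 N M i j = mMat 𝕜 N M j i := by
  by_cases h : i = j
  · rw [h]
  · simp [mMat, h, Ne.symm h]

theorem sum_mMat_mul (i : Fin N ⊕ Fin M) (x : Fin N ⊕ Fin M → 𝕜) :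
    ∑ j, mMat 𝕜 N M i j * x j = ∑ j, x j - ((eps i : ℤ) : 𝕜) * ((N : 𝕜) - M) * x i := by
  rw [← Finset.add_sum_erase _ _ (Finset.mem_univ i),
    ← Finset.add_sum_erase _ x (Finset.mem_univ i)]
  have : ∑ j ∈ Finset.univ.erase i, mMat 𝕜 N M i j * x j = ∑ j ∈ Finset.univ.erase i, x j :=
    Finset.sum_congr rfl fun j hj => by simp [mMat, (Finset.ne_of_mem_erase hj).symm]
  rw [this]
  simp only [mMat, if_true]
  ring

/-- The components of `m · (u ∂H/∂u)`. -/
theorem sum_mMat_mul_grad (hNM : M < N) {n : ℕ} (hn : 1 ≤ n) (i : Fin N ⊕ Fin M)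
    (u : Fin N ⊕ Fin M → 𝕜) :
    ∑ j, mMat 𝕜 N M i j
        * (u j * ((n : 𝕜)⁻¹ * ((laxExp n j : 𝕜) * coeff n (X * genFun (dec (laxExp n) j) u))))
      = coeff n (genFun (dec (laxExp n) i) u) := by
  have hn0 : (n : 𝕜) ≠ 0 := by exact_mod_cast (by omega : n ≠ 0)
  have hd := sub_ne_zero_of_lt 𝕜 hNM
  -- Euler's identity for the charge, homogeneous of degree `n`; the factor `n` cancels the `1/n` of
  -- the Hamiltonian.
  have hsum : ∑ j, u j * ((n : 𝕜)⁻¹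
      * ((laxExp n j : 𝕜) * coeff n (X * genFun (dec (laxExp n) j) u)))
        = coeff n (genFun (laxExp n) u) := by
    have h := genDeriv_self (laxExp n) n u
    rw [← mul_right_inj' hn0, ← h, genDeriv, Finset.mul_sum]
    refine Finset.sum_congr rfl fun j _ => ?_
    field_simp
  rw [sum_mMat_mul, hsum, coeff_genFun_eq _ u i, laxExp_eq]
  have he := eps_mul_self (𝕜 := 𝕜) i
  -- The diagonal entry of `m` is normalized so that `ε_i (N-M) α_i / n = ε_i² = 1`.
  have : ((eps i : ℤ) : 𝕜) * ((N : 𝕜) - M) * (u i * ((n : 𝕜)⁻¹ * (((eps i : ℤ) : 𝕜) * n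
      / ((N : 𝕜) - M) * coeff n (X * genFun (dec (laxExp n) i) u))))
      = (((eps i : ℤ) : 𝕜) * ((eps i : ℤ) : 𝕜))
        * (u i * coeff n (X * genFun (dec (laxExp n) i) u)) := by
    field_simp
  rw [this, he]
  ring

/-- Since `m` is constant it passes under `𝒟`, and `m` applied to `u ∂H/∂u` is `[z^n] (G / (1 + u^i
z))`; the chain rule for `𝒟` gives the normal form. -/
theorem hydroOp_hamDensity (hNM : M < N) {n : ℕ} (hn : 1 ≤ n) (i : Fin N ⊕ Fin M)
    (a : ℕ → Fin N ⊕ Fin M → 𝕜) :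
    hydroOp gMat gammaSym (varDeriv (hamDensity n)) i a
      = a 0 i * genDeriv (dec (laxExp n) i) n (a 0) (a 1) := by
  have hφ : ContDiff 𝕜 ∞ fun u : Fin N ⊕ Fin M → 𝕜 => (n : 𝕜)⁻¹ * charge n u := by
    simp only [charge_eq_coeff]
    exact contDiff_const.mul (contDiff_coeff_genFun _ _)
  have hvar : ∀ j (a : ℕ → Fin N ⊕ Fin M → 𝕜), varDeriv (hamDensity n) j a
      = (n : 𝕜)⁻¹ * ((laxExp n j : 𝕜) * coeff n (X * genFun (dec (laxExp n) j) (a 0))) := by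
    intro j a
    refine (varDeriv_zeroth hφ j a).trans ?_
    rw [← coordPartial_coeff_genFun]
    simp only [coordPartial, charge_eq_coeff]
    exact deriv_const_mul_field _
  have hdiff : IsDiffFun Set.univ (hamDensity n : (ℕ → Fin N ⊕ Fin M → 𝕜) → 𝕜) :=
    (isDiffFunOfOrder_zero hφ).isDiffFun
  rw [hydroOp_affine (m := mMat 𝕜 N M) (κ := 1) (μ := 0) isOpen_univ (fun u i j => by simp [gMat])
    (fun u i j k => by simp [gammaSym]) (hdiff.varDeriv isOpen_univ) i (Set.mem_univ _),
    sum_mul_totalD _ fun j => (isDiffFun_affCoord 1 0 j).mul (hdiff.varDeriv isOpen_univ j)]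
  simp only [affCoord, one_mul, add_zero, hvar, sum_mMat_mul_grad hNM hn]
  rw [totalD_zeroth (contDiff_coeff_genFun _ _), genDeriv]
  congr 1
  refine Finset.sum_congr rfl fun j _ => ?_
  rw [coordPartial_coeff_genFun]
  ring

/-- In logarithmic variables `∂/∂ũ^j = u^j ∂/∂u^j`, so the gradient already carries the factor `u^j`
and the operator is `m 𝒟` itself. -/
theorem hydroOp_hamDensityLog (hNM : M < N) {n : ℕ} (hn : 1 ≤ n) (i : Fin N ⊕ Fin M)
    (a : ℕ → Fin N ⊕ Fin M → 𝕜) :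
    hydroOp (fun _ => mMat 𝕜 N M) 0 (varDeriv (hamDensityLog n)) i a
      = genDeriv (dec (laxExp n) i) n (fun j => NormedSpace.exp (a 0 j))
          (fun j => NormedSpace.exp (a 0 j) * a 1 j) := by
  have hφ : ContDiff 𝕜 ∞ fun w : Fin N ⊕ Fin M → 𝕜 =>
      (n : 𝕜)⁻¹ * charge n fun i => NormedSpace.exp (w i) := by
    simp only [charge_eq_coeff]
    exact contDiff_const.mul (contDiff_coeff_genFun_exp _ _)
  have hvar : ∀ j (a : ℕ → Fin N ⊕ Fin M → 𝕜), varDeriv (hamDensityLog n) j a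
      = NormedSpace.exp (a 0 j) * ((n : 𝕜)⁻¹ * ((laxExp n j : 𝕜)
        * coeff n (X * genFun (dec (laxExp n) j) fun i => NormedSpace.exp (a 0 i)))) := by
    intro j a
    refine (varDeriv_zeroth hφ j a).trans ?_
    have h := coordPartial_coeff_genFun_exp (laxExp n) n j (a 0)
    simp only [coordPartial, charge_eq_coeff] at h ⊢
    rw [deriv_const_mul_field, h]
    ring
  have hdiff : IsDiffFun Set.univ (hamDensityLog n : (ℕ → Fin N ⊕ Fin M → 𝕜) → 𝕜) :=
    (isDiffFunOfOrder_zero hφ).isDiffFun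
  rw [hydroOp_affine (m := mMat 𝕜 N M) (κ := 0) (μ := 1) isOpen_univ (fun u i j => by simp)
    (fun u i j k => by simp) (hdiff.varDeriv isOpen_univ) i (Set.mem_univ _),
    sum_mul_totalD _ fun j => (isDiffFun_affCoord 0 1 j).mul (hdiff.varDeriv isOpen_univ j)]
  simp only [affCoord, zero_mul, zero_add, one_mul, hvar, sum_mMat_mul_grad hNM hn _ fun i => NormedSpace.exp _]
  rw [totalD_zeroth (contDiff_coeff_genFun_exp _ _), genDeriv]
  refine Finset.sum_congr rfl fun j _ => ?_
  rw [coordPartial_coeff_genFun_exp]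
  ring

end Flows

/-! ### The polynomial part at infinity -/

section PolyPart

set_option linter.unusedSectionVars false

open PowerSeries hiding binomialSeries

variable {𝕜 : Type*} [RCLike 𝕜]

/-- The part of `p^n F(1/p)` with non-negative powers of `p`. -/
def polyPart (n : ℕ) (F : PowerSeries 𝕜) (p : 𝕜) : 𝕜 :=
  ∑ k ∈ Finset.range (n + 1), p ^ k * coeff (n - k) F

theorem polyPart_add (n : ℕ) (F G : PowerSeries 𝕜) (p : 𝕜) :
    polyPart n (F + G) p = polyPart n F p + polyPart n G p := by
  simp only [polyPart, map_add, mul_add, Finset.sum_add_distrib]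

theorem polyPart_C_mul (n : ℕ) (c : 𝕜) (F : PowerSeries 𝕜) (p : 𝕜) :
    polyPart n (C c * F) p = c * polyPart n F p := by
  simp only [polyPart, coeff_C_mul, Finset.mul_sum]
  exact Finset.sum_congr rfl fun k _ => by ring

theorem polyPart_zero (n : ℕ) (p : 𝕜) : polyPart n (0 : PowerSeries 𝕜) p = 0 := by
  simp [polyPart]

theorem polyPart_sum {σ : Type*} (s : Finset σ) (n : ℕ) (F : σ → PowerSeries 𝕜) (p : 𝕜) :
    polyPart n (∑ i ∈ s, F i) p = ∑ i ∈ s, polyPart n (F i) p := by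
  simp only [polyPart, map_sum, Finset.mul_sum]
  exact Finset.sum_comm

theorem polyPart_succ (n : ℕ) (F : PowerSeries 𝕜) (p : 𝕜) :
    polyPart (n + 1) F p = coeff (n + 1) F + p * polyPart n F p := by
  rw [polyPart, Finset.sum_range_succ', polyPart, Finset.mul_sum, add_comm]
  congr 1
  · simp
  · refine Finset.sum_congr rfl fun k _ => ?_
    rw [Nat.add_sub_add_right, pow_succ']
    ring

theorem polyPart_succ_X_mul (n : ℕ) (F : PowerSeries 𝕜) (p : 𝕜) :
    polyPart (n + 1) (X * F) p = polyPart n F p := by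
  rw [polyPart, Finset.sum_range_succ, Nat.sub_self, coeff_zero_X_mul, mul_zero, add_zero, polyPart]
  refine Finset.sum_congr rfl fun k hk => ?_
  rw [Nat.succ_sub (Nat.lt_succ_iff.1 (Finset.mem_range.1 hk)), coeff_succ_X_mul]

/-- Division with remainder by `p + c`. -/
theorem polyPart_succ_one_add_mul (n : ℕ) (c : 𝕜) (H : PowerSeries 𝕜) (p : 𝕜) :
    polyPart (n + 1) ((1 + C c * X) * H) p = coeff (n + 1) H + (p + c) * polyPart n H p := by
  rw [add_mul, one_mul, mul_assoc, polyPart_add, polyPart_C_mul, polyPart_succ_X_mul, polyPart_succ]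
  ring

/-- The geometric series `1 / (1 + c z)`. -/
def geomInv (c : 𝕜) : PowerSeries 𝕜 := (1 + C c * X)⁻¹

theorem one_add_mul_geomInv (c : 𝕜) : (1 + C c * X) * geomInv c = 1 :=
  PowerSeries.mul_inv_cancel _ (by simp)

variable {ι : Type*} [Fintype ι] [DecidableEq ι]

theorem genFun_dec_eq (α : ι → ℚ) (u : ι → 𝕜) (j : ι) :
    genFun (dec α j) u = geomInv (u j) * genFun α u := by
  rw [genFun_eq_mul_dec α u j, ← mul_assoc, mul_comm (geomInv (u j)), one_add_mul_geomInv, one_mul]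

/-- The power series `∑_j α_j / (1 + u^j z) ∏_i (1 + u^i z)^{α_i}`. -/
def eulerSeries (α : ι → ℚ) (u : ι → 𝕜) : PowerSeries 𝕜 :=
  ∑ j, C (α j : 𝕜) * genFun (dec α j) u

/-- The derivative of `∏_i (1 + u^i z)^{α_i}` in the direction `v`. -/
def genDerivSeries (α : ι → ℚ) (u v : ι → 𝕜) : PowerSeries 𝕜 :=
  ∑ j, C ((α j : 𝕜) * v j) * (X * genFun (dec α j) u)

theorem coeff_genDerivSeries (α : ι → ℚ) (k : ℕ) (u v : ι → 𝕜) :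
    coeff k (genDerivSeries α u v) = genDeriv α k u v := by
  simp only [genDerivSeries, genDeriv, map_sum, coeff_C_mul]

/-- Because `∑ α_j = n`, the Euler operator `p ∂_p` takes `p^n G` to `p^n ∑_j α_j G / (1 + u^j z)`.
In coefficients this is `n - (n - k) = k`, the subtracted part coming from homogeneity in `u`. -/
theorem coeff_eulerSeries {α : ι → ℚ} {n : ℕ} (hα : ∑ j, α j = n) (u : ι → 𝕜) {k : ℕ} (hk : k ≤ n) :
    coeff (n - k) (eulerSeries α u) = k * coeff (n - k) (genFun α u) := by
  have h := genDeriv_self α (n - k) u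
  have h1 : coeff (n - k) (eulerSeries α u)
      = (∑ j, (α j : 𝕜)) * coeff (n - k) (genFun α u) - genDeriv α (n - k) u u := by
    rw [eulerSeries, genDeriv, map_sum, Finset.sum_mul, ← Finset.sum_sub_distrib]
    refine Finset.sum_congr rfl fun j _ => ?_
    rw [coeff_C_mul, coeff_genFun_eq α u j]
    ring
  have hα' : ∑ j, (α j : 𝕜) = n := by exact_mod_cast congrArg (Rat.cast : ℚ → 𝕜) hα
  rw [h1, h, hα', Nat.cast_sub hk]
  ring

/-- The numerator of the `i`-th partial fraction of the Lax bracket divided by `L`. -/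
def laxNumer (α : ι → ℚ) (n : ℕ) (u v : ι → 𝕜) (c p : 𝕜) : 𝕜 :=
  c * polyPart n (eulerSeries α u) p - p * polyPart n (genDerivSeries α u v) p

/-- Remainder theorem: modulo `p + u^i` the polynomial part of `p^n (1 + u^i z) H` is the constant
`[z^n] H`. -/
theorem polyPart_genFun_neg (α : ι → ℚ) {n : ℕ} (hn : 1 ≤ n) (u : ι → 𝕜) (i : ι) :
    polyPart n (genFun α u) (-u i) = coeff n (genFun (dec α i) u) := by
  obtain ⟨n, rfl⟩ : ∃ k, n = k + 1 := ⟨n - 1, by omega⟩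
  rw [genFun_eq_mul_dec α u i, polyPart_succ_one_add_mul]
  ring

theorem natCast_mul_pow_pred (k : ℕ) (p : 𝕜) : p * (k * p ^ (k - 1)) = k * p ^ k := by
  rcases k with _ | k
  · simp
  · rw [Nat.add_sub_cancel, pow_succ]
    ring

theorem polyPart_eulerSeries {α : ι → ℚ} {n : ℕ} (hα : ∑ j, α j = n) (u : ι → 𝕜) (p : 𝕜) :
    polyPart n (eulerSeries α u) p
      = p * ∑ k ∈ Finset.range (n + 1), (k : 𝕜) * p ^ (k - 1) * coeff (n - k) (genFun α u) := by
  rw [polyPart, Finset.mul_sum]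
  refine Finset.sum_congr rfl fun k hk => ?_
  rw [coeff_eulerSeries hα u (Nat.lt_succ_iff.1 (Finset.mem_range.1 hk)), ← mul_assoc p,
    natCast_mul_pow_pred]
  ring

theorem polyPart_genDerivSeries (α : ι → ℚ) (n : ℕ) (u v : ι → 𝕜) (p : 𝕜) :
    polyPart n (genDerivSeries α u v) p
      = ∑ k ∈ Finset.range (n + 1), p ^ k * genDeriv α (n - k) u v := by
  simp only [polyPart, coeff_genDerivSeries]

/-- The identity of `polyPart_genFun_neg` is differentiated along `u + t v`. The evaluation point
`-u^i` moves as well, and this gives the `∂_p` term of the bracket; the overall factor `u^i` is `-p`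
at `p = -u^i`. -/
theorem laxNumer_neg {α : ι → ℚ} {n : ℕ} (hα : ∑ j, α j = n) (hn : 1 ≤ n) (u v : ι → 𝕜) (i : ι) :
    laxNumer α n u v (v i) (-u i) = u i * genDeriv (dec α i) n u v := by
  have hu : ∀ j, HasDerivAt (fun t : 𝕜 => u j + t * v j) (v j) 0 := fun j => by
    simpa using ((hasDerivAt_id' (0 : 𝕜)).mul_const (v j)).const_add (u j)
  have h1 := hasDerivAt_coeff_genFun (t := (0 : 𝕜)) (u := fun t j => u j + t * v j) hu (dec α i) n
  have h2 : HasDerivAt (fun t : 𝕜 => polyPart n (genFun α fun j => u j + t * v j) (-(u i + t * v i)))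
      (∑ k ∈ Finset.range (n + 1), ((k : 𝕜) * (-u i) ^ (k - 1) * (-v i) * coeff (n - k) (genFun α u)
        + (-u i) ^ k * genDeriv α (n - k) u v)) 0 := by
    refine HasDerivAt.fun_sum fun k _ => ?_
    have h3 := ((hu i).neg.pow k).mul
      (hasDerivAt_coeff_genFun (t := (0 : 𝕜)) (u := fun t j => u j + t * v j) hu α (n - k))
    refine h3.congr_deriv ?_
    simp
  simp only [← polyPart_genFun_neg α hn (fun j => u j + _ * v j) i, zero_mul, add_zero] at h1
  rw [h1.unique h2, laxNumer, polyPart_eulerSeries hα, polyPart_genDerivSeries,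
    Finset.sum_add_distrib, mul_add, Finset.mul_sum, Finset.mul_sum, Finset.mul_sum, Finset.mul_sum,
    Finset.mul_sum, sub_eq_add_neg, ← Finset.sum_neg_distrib]
  congr 1
  · exact Finset.sum_congr rfl fun k _ => by ring
  · exact Finset.sum_congr rfl fun k _ => by ring

/-- Only the principal parts at the points `-u^i` contribute to the Lax bracket divided by `L`. -/
theorem sum_laxNumer_div {α : ι → ℚ} {n : ℕ} {e : ι → 𝕜} (he : ∀ i j, e i * α j = e j * α i)
    (u v : ι → 𝕜) (p : 𝕜) (hp : ∀ i, p + u i ≠ 0) :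
    ∑ i, e i * laxNumer α n u v (v i) p / (p + u i)
      = ∑ i, e i * laxNumer α n u v (v i) (-u i) / (p + u i) := by
  -- Up to an additive constant the `i`-th numerator is the polynomial part of `p^{n+1} F_i`. Its
  -- quotient by `p + u^i` is thus the polynomial part of `p^n F_i / (1 + u^i z)`, and the remainder
  -- is constant.
  let F : ι → PowerSeries 𝕜 := fun i => C (v i) * (X * eulerSeries α u)
    + C (-1) * genDerivSeries α u v
  have hR : ∀ i q, laxNumer α n u v (v i) q
      = coeff (n + 1) (geomInv (u i) * F i) + coeff (n + 1) (genDerivSeries α u v)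
        + (q + u i) * polyPart n (geomInv (u i) * F i) q := by
    intro i q
    have h1 := polyPart_succ_one_add_mul n (u i) (geomInv (u i) * F i) q
    rw [← mul_assoc, one_add_mul_geomInv, one_mul, polyPart_add, polyPart_C_mul, polyPart_C_mul,
      polyPart_succ_X_mul, polyPart_succ] at h1
    rw [laxNumer]
    linear_combination h1
  -- By `e_i α_j = e_j α_i` the weighted quotients are antisymmetrizations of `Z`, so their total
  -- vanishes.
  let Z : ι → ι → PowerSeries 𝕜 := fun i j => C (e i * α j * v i)
    * (X * (geomInv (u i) * geomInv (u j) * genFun α u))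
  have hF : ∀ i, C (e i) * (geomInv (u i) * F i) = ∑ j, (Z i j - Z j i) := by
    intro i
    simp only [F, eulerSeries, genDerivSeries, genFun_dec_eq, Finset.mul_sum,
      ← Finset.sum_add_distrib, Z]
    refine Finset.sum_congr rfl fun j _ => ?_
    rw [he j i]
    simp only [map_mul, map_neg, map_one]
    ring
  have hzero : ∑ i, C (e i) * (geomInv (u i) * F i) = 0 := by
    simp only [hF, Finset.sum_sub_distrib]
    rw [Finset.sum_comm, sub_self]
  have hpoly : ∑ i, e i * polyPart n (geomInv (u i) * F i) p = 0 := by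
    simp only [← polyPart_C_mul, ← polyPart_sum, hzero, polyPart_zero]
  rw [← sub_eq_zero, ← Finset.sum_sub_distrib, ← hpoly]
  refine Finset.sum_congr rfl fun i _ => ?_
  rw [hR i p, hR i (-u i)]
  field_simp [hp i]
  ring

/-- A sum of simple fractions vanishes only if its residues do. -/
theorem sum_residue_eq_zero (c u : ι → 𝕜)
    (h : ∀ p : 𝕜, (∀ i, p + u i ≠ 0) → ∑ i, c i / (p + u i) = 0) (i₀ : ι) :
    ∑ i ∈ Finset.univ.filter (fun i => u i = u i₀), c i = 0 := by
  have hne : ∀ᶠ p in nhdsWithin (-u i₀) {-u i₀}ᶜ, ∀ i, p + u i ≠ 0 := by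
    rw [Filter.eventually_all]
    intro i
    by_cases hi : u i = u i₀
    · filter_upwards [self_mem_nhdsWithin] with p hp h0
      exact hp (by rw [Set.mem_singleton_iff, ← hi]; exact eq_neg_of_add_eq_zero_left h0)
    · refine Filter.Eventually.filter_mono nhdsWithin_le_nhds ?_
      refine ContinuousAt.eventually_ne (by fun_prop) ?_
      rwa [ne_eq, neg_add_eq_zero, eq_comm]
  -- The sum is multiplied by `p + u^{i₀}` and `p` tends to `-u^{i₀}`; exactly the fractions with
  -- that same pole survive.
  have hlim : Filter.Tendsto (fun p => ∑ i, c i * ((p + u i₀) / (p + u i)))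
      (nhdsWithin (-u i₀) {-u i₀}ᶜ) (nhds (∑ i, c i * if u i = u i₀ then 1 else 0)) := by
    refine tendsto_finsetSum _ fun i _ => Filter.Tendsto.const_mul _ ?_
    split_ifs with hi
    · refine tendsto_const_nhds.congr' ?_
      filter_upwards [hne] with p hp
      rw [hi, div_self (hp i₀)]
    · have hc : ContinuousAt (fun p => (p + u i₀) / (p + u i)) (-u i₀) := by
        refine ContinuousAt.div (by fun_prop) (by fun_prop) ?_
        rwa [ne_eq, neg_add_eq_zero, eq_comm]
      have := hc.tendsto
      rw [neg_add_cancel, zero_div] at this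
      exact this.mono_left nhdsWithin_le_nhds
  have hz : Filter.Tendsto (fun p => ∑ i, c i * ((p + u i₀) / (p + u i)))
      (nhdsWithin (-u i₀) {-u i₀}ᶜ) (nhds 0) := by
    refine tendsto_const_nhds.congr' ?_
    filter_upwards [hne] with p hp
    rw [← mul_zero (p + u i₀), ← h p hp, Finset.mul_sum]
    exact Finset.sum_congr rfl fun i _ => by ring
  have := tendsto_nhds_unique hlim hz
  simpa [Finset.sum_filter] using this

end PolyPart

/-! ### The Lax equation at a point -/

section LaxPoint

open PowerSeries hiding binomialSeries

variable {𝕜 : Type*} [RCLike 𝕜] {N M : ℕ}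

theorem laxPlus_eval (n : ℕ) (u : Fin N ⊕ Fin M → 𝕜) (p : 𝕜) :
    (laxPlus n u).eval p = polyPart n (genFun (laxExp n) u) p := by
  rw [laxPlus, Polynomial.eval_finsetSum, polyPart]
  refine Finset.sum_congr rfl fun k hk => ?_
  rw [Polynomial.eval_monomial, laxPow_coeff_neg n u (Nat.lt_succ_iff.1 (Finset.mem_range.1 hk)),
    mul_comm]

theorem sum_laxExp (hNM : M < N) (n : ℕ) : ∑ i : Fin N ⊕ Fin M, laxExp n i = n := by
  have hd : ((N : ℚ) - M) ≠ 0 := sub_ne_zero.2 (by exact_mod_cast hNM.ne')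
  simp only [laxExp, Fintype.sum_sum_type, eps, Sum.elim_inl, Sum.elim_inr, Finset.sum_const,
    Finset.card_univ, Fintype.card_fin, nsmul_eq_mul]
  field_simp
  push_cast
  ring

theorem hasDerivAt_prod_zpow {𝕂 ι : Type*} [NontriviallyNormedField 𝕂] [NormedAlgebra 𝕂 𝕜]
    [Fintype ι] (e : ι → ℤ) {c : 𝕂 → ι → 𝕜} {c' : ι → 𝕜} {t : 𝕂}
    (hc : ∀ i, HasDerivAt (fun s => c s i) (c' i) t) (h0 : ∀ i, c t i ≠ 0) :
    HasDerivAt (fun s => ∏ i, c s i ^ e i) ((∏ i, c t i ^ e i) * ∑ i, e i * c' i / c t i) t := by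
  classical
  have key : ∀ s : Finset ι, HasDerivAt (fun r => ∏ i ∈ s, c r i ^ e i)
      ((∏ i ∈ s, c t i ^ e i) * ∑ i ∈ s, e i * c' i / c t i) t := by
    intro s
    induction s using Finset.induction_on with
    | empty => simpa using hasDerivAt_const t (1 : 𝕜)
    | insert i s hi ih =>
      simp only [Finset.prod_insert hi, Finset.sum_insert hi]
      have h1 := (hasDerivAt_zpow (e i) (c t i) (Or.inl (h0 i))).comp t (hc i)
      refine (h1.mul ih).congr_deriv ?_
      simp only [Function.comp_apply]
      rw [zpow_sub_one₀ (h0 i)]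
      field_simp [h0 i]
  exact key Finset.univ

/-- The Lax equation at a point, in terms of the partial fraction decomposition. -/
theorem lax_equation_iff (hNM : M < N) {n : ℕ} (hn : 1 ≤ n) {u : ℝ → ℝ → Fin N ⊕ Fin M → 𝕜}
    {x τ : ℝ} {v s : Fin N ⊕ Fin M → 𝕜} (hx : ∀ i, HasDerivAt (fun y => u y τ i) (v i) x)
    (hτ : ∀ i, HasDerivAt (fun r => u x r i) (s i) τ) {p : 𝕜} (hp : ∀ i, p + u x τ i ≠ 0) :
    deriv (fun r => lax (u x r) p) τ
        = laxBracket (fun y q => (laxPlus n (u y τ)).eval q) (fun y q => lax (u y τ) q) x p ↔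
      ∑ i, ((eps i : ℤ) : 𝕜) * (s i - u x τ i * genDeriv (dec (laxExp n) i) n (u x τ) v)
        / (p + u x τ i) = 0 := by
  have hα := sum_laxExp hNM n
  have hL : ∏ i, (p + u x τ i) ^ eps i ≠ 0 := Finset.prod_ne_zero_iff.2 fun i _ => zpow_ne_zero _ (hp i)
  have e1 : deriv (fun r => lax (u x r) p) τ = _ :=
    (hasDerivAt_prod_zpow eps (fun i => (hτ i).const_add p) hp).deriv
  have e2 : deriv (fun y => lax (u y τ) p) x = _ :=
    (hasDerivAt_prod_zpow eps (fun i => (hx i).const_add p) hp).deriv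
  have e3 : deriv (fun q => lax (u x τ) q) p = _ :=
    (hasDerivAt_prod_zpow (𝕂 := 𝕜) (t := p) (c := fun q i => q + u x τ i) eps
      (fun i => (hasDerivAt_id' p).add_const (u x τ i)) hp).deriv
  have e4 : deriv (fun q => (laxPlus n (u x τ)).eval q) p
      = ∑ k ∈ Finset.range (n + 1),
        (k : 𝕜) * p ^ (k - 1) * coeff (n - k) (genFun (laxExp n) (u x τ)) := by
    simp only [laxPlus_eval]
    exact (HasDerivAt.fun_sum fun k _ => (hasDerivAt_pow k p).mul_const _).deriv
  have e5 : deriv (fun y => (laxPlus n (u y τ)).eval p) x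
      = polyPart n (genDerivSeries (laxExp n) (u x τ) v) p := by
    simp only [laxPlus_eval, polyPart_genDerivSeries]
    exact (HasDerivAt.fun_sum fun k _ =>
      (hasDerivAt_coeff_genFun hx (laxExp n) (n - k)).const_mul (p ^ k)).deriv
  have hbr : laxBracket (fun y q => (laxPlus n (u y τ)).eval q) (fun y q => lax (u y τ) q) x p
      = (∏ i, (p + u x τ i) ^ eps i)
        * ∑ i, ((eps i : ℤ) : 𝕜) * laxNumer (laxExp n) n (u x τ) v (v i) p / (p + u x τ i) := by
    have h1 : ∀ i, ((eps i : ℤ) : 𝕜) * laxNumer (laxExp n) n (u x τ) v (v i) p / (p + u x τ i)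
        = polyPart n (eulerSeries (laxExp n) (u x τ)) p * (((eps i : ℤ) : 𝕜) * v i / (p + u x τ i))
          - p * polyPart n (genDerivSeries (laxExp n) (u x τ) v) p
            * (((eps i : ℤ) : 𝕜) * 1 / (p + u x τ i)) := fun i => by
      rw [laxNumer]
      ring
    simp only [laxBracket, e2, e3, e4, e5, h1, Finset.sum_sub_distrib, ← Finset.mul_sum]
    rw [polyPart_eulerSeries hα]
    ring
  have he : ∀ i j : Fin N ⊕ Fin M, ((eps i : ℤ) : 𝕜) * (laxExp n j : 𝕜)
      = ((eps j : ℤ) : 𝕜) * (laxExp n i : 𝕜) := fun i j => by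
    rw [laxExp_eq, laxExp_eq]
    ring
  rw [e1, hbr, sum_laxNumer_div he _ _ _ hp, mul_right_inj' hL, ← sub_eq_zero,
    ← Finset.sum_sub_distrib]
  simp only [laxNumer_neg hα hn, ← sub_div, ← mul_sub]

end LaxPoint

/-! ### Fields on the `(x, τ)`-plane -/

section Fields

set_option linter.unusedSectionVars false

variable {𝕜 : Type*} [RCLike 𝕜] {ι : Type*} [Fintype ι] [DecidableEq ι] {Ω : Set (ℝ × ℝ)}
  {v : ℝ → ℝ → ι → 𝕜}

theorem hasDerivAt_fst_snd (hΩ : IsOpen Ω)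
    (hv : ContDiffOn ℝ 1 (fun z : ℝ × ℝ => v z.1 z.2) Ω) {x τ : ℝ} (hz : (x, τ) ∈ Ω) (i : ι) :
    HasDerivAt (fun y => v y τ i) (fderiv ℝ (fun z : ℝ × ℝ => v z.1 z.2) (x, τ) (1, 0) i) x ∧
      HasDerivAt (fun s => v x s i) (fderiv ℝ (fun z : ℝ × ℝ => v z.1 z.2) (x, τ) (0, 1) i) τ := by
  have hd : HasFDerivAt (fun z : ℝ × ℝ => v z.1 z.2)
      (fderiv ℝ (fun z : ℝ × ℝ => v z.1 z.2) (x, τ)) (x, τ) :=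
    ((hv.contDiffAt (hΩ.mem_nhds hz)).differentiableAt (by simp)).hasFDerivAt
  exact ⟨hasDerivAt_pi.1 (hd.comp_hasDerivAt x
      ((hasDerivAt_id' x).prodMk (hasDerivAt_const x τ))) i,
    hasDerivAt_pi.1 (hd.comp_hasDerivAt τ
      ((hasDerivAt_const τ x).prodMk (hasDerivAt_id' τ))) i⟩

theorem continuousOn_deriv_fst_snd (hΩ : IsOpen Ω)
    (hv : ContDiffOn ℝ 1 (fun z : ℝ × ℝ => v z.1 z.2) Ω) (i : ι) :
    ContinuousOn (fun z : ℝ × ℝ => deriv (fun y => v y z.2 i) z.1) Ω ∧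
      ContinuousOn (fun z : ℝ × ℝ => deriv (fun s => v z.1 s i) z.2) Ω := by
  have hc := hv.continuousOn_fderiv_of_isOpen hΩ le_rfl
  have hc' : ∀ e : ℝ × ℝ,
      ContinuousOn (fun z => fderiv ℝ (fun z : ℝ × ℝ => v z.1 z.2) z e i) Ω := fun e =>
    (continuous_apply i).comp_continuousOn (hc.clm_apply continuousOn_const)
  exact ⟨(hc' (1, 0)).congr fun z hz => (hasDerivAt_fst_snd hΩ hv hz i).1.deriv,
    (hc' (0, 1)).congr fun z hz => (hasDerivAt_fst_snd hΩ hv hz i).2.deriv⟩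

theorem contDiffOn_exp_fields {w u : ℝ → ℝ → ι → 𝕜}
    (hw : ContDiffOn ℝ 1 (fun z : ℝ × ℝ => w z.1 z.2) Ω)
    (hu : ∀ x τ i, u x τ i = NormedSpace.exp (w x τ i)) :
    ContDiffOn ℝ 1 (fun z : ℝ × ℝ => u z.1 z.2) Ω := by
  refine contDiffOn_pi.2 fun i => ?_
  simp only [hu]
  exact ((contDiff_exp (𝕜 := 𝕜)).restrict_scalars ℝ |>.of_le (by simp)).comp_contDiffOn
    (contDiffOn_pi.1 hw i)

/-- The points at which the pattern of coincidences between the components of a continuous field is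
locally constant are dense. -/
theorem exists_locally_constant_coincidences {V : Set (ℝ × ℝ)} (hV : IsOpen V)
    (hv : ContinuousOn (fun z : ℝ × ℝ => v z.1 z.2) V) (hne : V.Nonempty) :
    ∃ z ∈ V, ∀ i j, v z.1 z.2 i = v z.1 z.2 j → ∀ᶠ z' in nhds z, v z'.1 z'.2 i = v z'.1 z'.2 j := by
  classical
  let S (z : ℝ × ℝ) : Finset (ι × ι) :=
    Finset.univ.filter fun q => v z.1 z.2 q.1 = v z.1 z.2 q.2
  -- A point with the fewest coincidences works: inequalities persist nearby, so no new coincidence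
  -- appears, and by minimality none is lost.
  obtain ⟨z, hz, hmin⟩ : ∃ z ∈ V, ∀ z' ∈ V, (S z).card ≤ (S z').card := by
    have hne' : ((fun z => (S z).card) '' V).Nonempty := hne.image _
    obtain ⟨z, hz, hz'⟩ := Nat.sInf_mem hne'
    exact ⟨z, hz, fun z' h' => by
      rw [show (S z).card = _ from hz']
      exact Nat.sInf_le (Set.mem_image_of_mem _ h')⟩
  refine ⟨z, hz, fun i j hij => ?_⟩
  have hsub : ∀ᶠ z' in nhds z, S z' ⊆ S z := by
    have : ∀ q : ι × ι, ∀ᶠ z' in nhds z, q ∈ S z' → q ∈ S z := by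
      intro q
      by_cases hq : q ∈ S z
      · exact Filter.Eventually.of_forall fun _ _ => hq
      · have hc : ContinuousAt (fun z : ℝ × ℝ => v z.1 z.2) z := hv.continuousAt (hV.mem_nhds hz)
        have h1 : ContinuousAt (fun z : ℝ × ℝ => v z.1 z.2 q.1) z :=
          (continuous_apply q.1).continuousAt.comp hc
        have h2 : ContinuousAt (fun z : ℝ × ℝ => v z.1 z.2 q.2) z :=
          (continuous_apply q.2).continuousAt.comp hc
        have hq' : v z.1 z.2 q.1 ≠ v z.1 z.2 q.2 := by simpa [S] using hq
        filter_upwards [(h1.ne_iff_eventually_ne h2).1 hq'] with z' hz' hmem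
        exact absurd (by simpa [S] using hmem) hz'
    filter_upwards [Filter.eventually_all.2 this] with z' hz' q hq using hz' q hq
  filter_upwards [hsub, hV.mem_nhds hz] with z' hz' hV'
  have heq := Finset.eq_of_subset_of_card_le hz' (hmin z' hV')
  have : (i, j) ∈ S z' := by
    rw [heq]
    simpa [S] using hij
  simpa [S] using this

theorem deriv_eq_of_eventually_eq {i j : ι} {x τ : ℝ}
    (h : ∀ᶠ z in nhds (x, τ), v z.1 z.2 i = v z.1 z.2 j) :
    deriv (fun y => v y τ i) x = deriv (fun y => v y τ j) x ∧
      deriv (fun s => v x s i) τ = deriv (fun s => v x s j) τ := by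
  have h1 : Filter.Tendsto (fun y => (y, τ)) (nhds x) (nhds (x, τ)) :=
    (Continuous.prodMk continuous_id continuous_const).tendsto x
  have h2 : Filter.Tendsto (fun s => (x, s)) (nhds τ) (nhds (x, τ)) :=
    (Continuous.prodMk continuous_const continuous_id).tendsto τ
  exact ⟨Filter.EventuallyEq.deriv_eq (h1.eventually h),
    Filter.EventuallyEq.deriv_eq (h2.eventually h)⟩

theorem continuousOn_genDeriv {X : Type*} [TopologicalSpace X] {s : Set X} {f g : X → ι → 𝕜}
    (hf : ContinuousOn f s) (hg : ContinuousOn g s) (α : ι → ℚ) (k : ℕ) :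
    ContinuousOn (fun z => genDeriv α k (f z) (g z)) s := by
  unfold genDeriv
  refine continuousOn_finsetSum _ fun j _ =>
    (continuousOn_const.mul (continuousOn_pi.1 hg j)).mul ?_
  rcases k with _ | k
  · simpa using continuousOn_const
  · simp only [PowerSeries.coeff_succ_X_mul]
    exact (contDiff_coeff_genFun (dec α j) k).continuous.comp_continuousOn hf

end Fields

/-! ### Equivalence of the evolution equations -/

section Equivalence

variable {𝕜 : Type*} [RCLike 𝕜] {N M : ℕ} {n : ℕ} {Ω : Set (ℝ × ℝ)}
  {w u : ℝ → ℝ → Fin N ⊕ Fin M → 𝕜}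

/-- The defect of the evolution equation of `u^i` at `(x, τ)`. -/
def flowDefect (n : ℕ) (u : ℝ → ℝ → Fin N ⊕ Fin M → 𝕜) (i : Fin N ⊕ Fin M) (x τ : ℝ) : 𝕜 :=
  deriv (fun s => u x s i) τ
    - u x τ i * genDeriv (dec (laxExp n) i) n (u x τ) (fun j => deriv (fun y => u y τ j) x)

theorem jet_zero {ι : Type*} (v : ℝ → ι → 𝕜) (x : ℝ) : jet v x 0 = v x := by
  funext i
  simp [jet]

theorem jet_one {ι : Type*} (v : ℝ → ι → 𝕜) (x : ℝ) :
    jet v x 1 = fun i => deriv (fun y => v y i) x := by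
  funext i
  simp [jet]

theorem isModifiedFlow_iff (hn : 1 ≤ n) :
    IsModifiedFlow n Ω u ↔ ∀ x τ, (x, τ) ∈ Ω → ∀ i, flowDefect n u i x τ = 0 := by
  simp only [IsModifiedFlow, flowDefect, sub_eq_zero]
  refine forall_congr' fun x => forall_congr' fun τ => imp_congr_right fun _ => forall_congr' fun i => ?_
  rw [← modified_rhs_eq hn i (u x τ) fun j => deriv (fun y => u y τ j) x]

theorem isHamiltonianFlow_hamDensity_iff (hNM : M < N) (hn : 1 ≤ n) :
    IsHamiltonianFlow gMat gammaSym (hamDensity n) Ω u ↔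
      ∀ x τ, (x, τ) ∈ Ω → ∀ i, flowDefect n u i x τ = 0 := by
  simp only [IsHamiltonianFlow, flowDefect, sub_eq_zero, hydroOp_hamDensity hNM hn,
    jet_zero, jet_one]

theorem isHamiltonianFlow_hamDensityLog_iff (hNM : M < N) (hn : 1 ≤ n) (hΩ : IsOpen Ω)
    (hw : ContDiffOn ℝ 1 (fun z : ℝ × ℝ => w z.1 z.2) Ω)
    (hu : ∀ x τ i, u x τ i = NormedSpace.exp (w x τ i)) :
    IsHamiltonianFlow (fun _ => mMat 𝕜 N M) 0 (hamDensityLog n) Ω w ↔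
      ∀ x τ, (x, τ) ∈ Ω → ∀ i, flowDefect n u i x τ = 0 := by
  simp only [IsHamiltonianFlow, flowDefect, sub_eq_zero, hydroOp_hamDensityLog hNM hn,
    jet_zero, jet_one]
  refine forall_congr' fun x => forall_congr' fun τ => imp_congr_right fun hz => forall_congr' fun i => ?_
  have hx : ∀ j, deriv (fun y => u y τ j) x
      = NormedSpace.exp (w x τ j) * deriv (fun y => w y τ j) x := fun j => by
    simp only [hu]
    exact ((hasDerivAt_exp (x := w x τ j)).comp x
      (hasDerivAt_fst_snd hΩ hw hz j).1.differentiableAt.hasDerivAt).deriv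
  have hτ : deriv (fun s => u x s i) τ
      = NormedSpace.exp (w x τ i) * deriv (fun s => w x s i) τ := by
    simp only [hu]
    exact ((hasDerivAt_exp (x := w x τ i)).comp τ
      (hasDerivAt_fst_snd hΩ hw hz i).2.differentiableAt.hasDerivAt).deriv
  have hux : u x τ = fun j => NormedSpace.exp (w x τ j) := funext fun j => hu x τ j
  simp only [hx, hτ, hux]
  -- The equation for `u^i` is that for `ũ^i` multiplied by the nonvanishing `u^i`.
  exact (mul_right_inj' (exp_ne_zero _)).symm

theorem continuousOn_flowDefect (hΩ : IsOpen Ω)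
    (hu : ContDiffOn ℝ 1 (fun z : ℝ × ℝ => u z.1 z.2) Ω) (i : Fin N ⊕ Fin M) :
    ContinuousOn (fun z : ℝ × ℝ => flowDefect n u i z.1 z.2) Ω := by
  have hv : ContinuousOn (fun (z : ℝ × ℝ) j => deriv (fun y => u y z.2 j) z.1) Ω :=
    continuousOn_pi.2 fun j => (continuousOn_deriv_fst_snd hΩ hu j).1
  have hc : ContinuousOn (fun z : ℝ × ℝ => genDeriv (dec (laxExp n) i) n (u z.1 z.2)
      (fun j => deriv (fun y => u y z.2 j) z.1)) Ω :=
    continuousOn_genDeriv hu.continuousOn hv _ _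
  have hi : ContinuousOn (fun z : ℝ × ℝ => u z.1 z.2 i) Ω := continuousOn_pi.1 hu.continuousOn i
  unfold flowDefect
  exact (continuousOn_deriv_fst_snd hΩ hu i).2.sub (hi.mul hc)

/-- Where the coincidences between zeros or between poles are locally constant, the Lax equation
determines the velocity of each of them. -/
theorem flowDefect_eq_zero_of_residues (hNM : M < N) (hn : 1 ≤ n) {x τ : ℝ}
    (hne : ∀ (i : Fin N) (j : Fin M), u x τ (Sum.inl i) ≠ u x τ (Sum.inr j))
    (hloc : ∀ i j, u x τ i = u x τ j → ∀ᶠ z in nhds (x, τ), u z.1 z.2 i = u z.1 z.2 j)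
    (hlax : ∀ p : 𝕜, (∀ i, p + u x τ i ≠ 0) →
      ∑ i, ((eps i : ℤ) : 𝕜) * flowDefect n u i x τ / (p + u x τ i) = 0) (i : Fin N ⊕ Fin M) :
    flowDefect n u i x τ = 0 := by
  have hres := sum_residue_eq_zero (fun i => ((eps i : ℤ) : 𝕜) * flowDefect n u i x τ) (u x τ) hlax i
  have hα := sum_laxExp hNM n
  -- Coinciding roots have the same sign `ε`, as no zero meets a pole. By `laxNumer_neg` the spatial
  -- part of the defect depends on the index only through `u^i` and `u^i_x`, so all their defects
  -- agree and the residue is a positive multiple of one of them.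
  have hconst : ∀ j ∈ Finset.univ.filter (fun j => u x τ j = u x τ i),
      ((eps j : ℤ) : 𝕜) * flowDefect n u j x τ = ((eps i : ℤ) : 𝕜) * flowDefect n u i x τ := by
    intro j hj
    have hji : u x τ j = u x τ i := (Finset.mem_filter.1 hj).2
    have heps : eps j = eps i := by
      rcases i with i | i <;> rcases j with j | j
      · rfl
      · exact absurd hji.symm (hne i j)
      · exact absurd hji (hne j i)
      · rfl
    obtain ⟨h1, h2⟩ := deriv_eq_of_eventually_eq (hloc j i hji)
    rw [heps, flowDefect, flowDefect, ← laxNumer_neg hα hn, ← laxNumer_neg hα hn, h1, h2, hji]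
  rw [Finset.sum_congr rfl hconst, Finset.sum_const, nsmul_eq_mul] at hres
  have hcard : ((Finset.univ.filter (fun j => u x τ j = u x τ i)).card : 𝕜) ≠ 0 := by
    exact_mod_cast (Finset.card_pos.2 ⟨i, by simp⟩).ne'
  have heps : ((eps i : ℤ) : 𝕜) ≠ 0 := fun h => by
    simpa [h] using eps_mul_self (𝕜 := 𝕜) i
  exact (mul_eq_zero.1 ((mul_eq_zero.1 hres).resolve_left hcard)).resolve_left heps

/-- Pointwise, the Lax equation controls only sums of residues over coinciding roots. If some defect
were nonzero at a point, it would be nonzero on an open set by continuity, and that set contains a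
point where the coincidences are locally constant, a contradiction. -/
theorem isLaxFlow_iff (hNM : M < N) (hn : 1 ≤ n) (hΩ : IsOpen Ω)
    (hu : ContDiffOn ℝ 1 (fun z : ℝ × ℝ => u z.1 z.2) Ω)
    (hne : ∀ x τ, (x, τ) ∈ Ω → ∀ (i : Fin N) (j : Fin M), u x τ (Sum.inl i) ≠ u x τ (Sum.inr j)) :
    IsLaxFlow n Ω u ↔ ∀ x τ, (x, τ) ∈ Ω → ∀ i, flowDefect n u i x τ = 0 := by
  have hpoint : IsLaxFlow n Ω u ↔ ∀ x τ, (x, τ) ∈ Ω → ∀ p : 𝕜, (∀ i, p + u x τ i ≠ 0) →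
      ∑ i, ((eps i : ℤ) : 𝕜) * flowDefect n u i x τ / (p + u x τ i) = 0 := by
    refine forall_congr' fun x => forall_congr' fun τ => imp_congr_right fun hz =>
      forall_congr' fun p => imp_congr_right fun hp => ?_
    exact lax_equation_iff hNM hn
      (fun i => (hasDerivAt_fst_snd hΩ hu hz i).1.differentiableAt.hasDerivAt)
      (fun i => (hasDerivAt_fst_snd hΩ hu hz i).2.differentiableAt.hasDerivAt) hp
  rw [hpoint]
  refine ⟨fun h x τ hz i => ?_, fun h x τ hz p _ => Finset.sum_eq_zero fun i _ => by
    rw [h x τ hz i, mul_zero, zero_div]⟩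
  by_contra hi
  let V : Set (ℝ × ℝ) := Ω ∩ (fun z : ℝ × ℝ => flowDefect n u i z.1 z.2) ⁻¹' {0}ᶜ
  have hV : IsOpen V :=
    (continuousOn_flowDefect hΩ hu i).isOpen_inter_preimage hΩ isOpen_compl_singleton
  obtain ⟨z, ⟨hzΩ, hzV⟩, hloc⟩ := exists_locally_constant_coincidences hV
    (hu.continuousOn.mono Set.inter_subset_left) ⟨(x, τ), hz, hi⟩
  exact hzV (flowDefect_eq_zero_of_residues hNM hn (hne z.1 z.2 hzΩ) hloc (h z.1 z.2 hzΩ) i)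

end Equivalence

/-! ### The Hamiltonian structure in the original variables -/

section Structure

variable {𝕜 : Type*} [RCLike 𝕜] {N M : ℕ}

theorem coordPartial_gammaSym (q i j k : Fin N ⊕ Fin M) (u : Fin N ⊕ Fin M → 𝕜) :
    coordPartial q (fun v => gammaSym v i j k) u
      = if j = k then (if i = q then mMat 𝕜 N M i j else 0) else 0 := by
  simp only [coordPartial, gammaSym]
  split_ifs with h1 h2
  · subst h2
    simp
  · simp [Function.update_of_ne h2]
  · simp

theorem coordPartial_gMat (q i j : Fin N ⊕ Fin M) (u : Fin N ⊕ Fin M → 𝕜) :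
    coordPartial q (fun v => gMat v i j) u
      = mMat 𝕜 N M i j * ((if i = q then u j else 0) + if j = q then u i else 0) := by
  have h := ((hasDerivAt_update_apply u q i (u q)).const_mul (mMat 𝕜 N M i j)).mul
    (hasDerivAt_update_apply u q j (u q))
  refine h.deriv.trans ?_
  simp only [Function.update_eq_self, Pi.single_apply]
  split_ifs <;> ring

/-- `Γ` is linear in `u` and carries a Kronecker delta, so each sum over `t` collapses. With the
deltas written as factors, the cyclic condition becomes a polynomial identity modulo the symmetry of
`m`. -/
theorem gdTerm_gammaSym (u : Fin N ⊕ Fin M → 𝕜) (q r i j k : Fin N ⊕ Fin M) :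
    gdTerm gammaSym u q r i j k
      = mMat 𝕜 N M i j * ((if k = r then 1 else 0) * ((if i = q then 1 else 0) * (mMat 𝕜 N M j k * u j)
          - (if j = q then 1 else 0) * (mMat 𝕜 N M i k * u i))
        + (if k = q then 1 else 0) * ((if i = r then 1 else 0) * (mMat 𝕜 N M j k * u j)
          - (if j = r then 1 else 0) * (mMat 𝕜 N M i k * u i))) := by
  have key : ∀ q r, ∑ t, (coordPartial q (fun v => gammaSym v i j t) u
      - coordPartial t (fun v => gammaSym v i j q) u) * gammaSym u t k r
      = mMat 𝕜 N M i j * ((if k = r then 1 else 0) * ((if i = q then 1 else 0) * (mMat 𝕜 N M j k * u j)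
          - (if j = q then 1 else 0) * (mMat 𝕜 N M i k * u i))) := by
    intro q r
    simp only [coordPartial_gammaSym]
    simp only [gammaSym, sub_mul, Finset.sum_sub_distrib, ite_mul, zero_mul,
      Finset.sum_ite_eq, Finset.mem_univ, if_true]
    by_cases h1 : k = r <;> by_cases h2 : i = q <;> by_cases h3 : j = q <;>
      simp [-Fintype.sum_sum_type, h1, h2, h3]
  rw [gdTerm, Finset.sum_add_distrib, key, key]
  ring

theorem grinbergDorfman_gMat :
    GrinbergDorfman (Set.univ : Set (Fin N ⊕ Fin M → 𝕜)) gMat gammaSym where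
  smooth_g i j := by
    simp only [gMat]
    exact ContDiff.contDiffOn (by fun_prop)
  smooth_Γ i j k := by
    simp only [gammaSym]
    split_ifs
    · exact ContDiff.contDiffOn (by fun_prop)
    · exact contDiffOn_const
  symm u _ i j := by
    simp only [gMat, mMat_symm i j]
    ring
  compat u _ i j k := by
    rw [coordPartial_gMat]
    simp only [gammaSym, mMat_symm j i]
    split_ifs <;> ring
  torsion u _ j r s := by
    simp only [gMat, gammaSym, mul_ite, mul_zero, Finset.sum_ite_eq, Finset.mem_univ, if_true]
    rw [mMat_symm s j]
    ring
  curvature u _ i j k r := by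
    simp only [coordPartial_gammaSym]
    simp only [gammaSym, gMat, mul_sub, Finset.sum_sub_distrib, mul_ite, ite_mul, zero_mul, mul_zero]
    by_cases h1 : k = r <;> by_cases h2 : j = r <;>
      simp [-Fintype.sum_sum_type, h1, h2, mMat_symm j i, mMat_symm k i, mMat_symm r i,
        mMat_symm r k] <;> ring
  cyclic u _ i j k q r := by
    simp only [gdTerm_gammaSym, mMat_symm j i, mMat_symm k i, mMat_symm k j]
    ring

theorem isHamiltonianStructure_mMat {U : Set (Fin N ⊕ Fin M → 𝕜)} (hU : IsOpen U) :
    IsHamiltonianStructure U (fun _ => mMat 𝕜 N M) 0 :=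
  isHamiltonianStructure_affine (κ := 0) (μ := 1) hU mMat_symm (fun u i j => by simp)
    fun u i j k => by simp

theorem isHamiltonianStructure_gMat {U : Set (Fin N ⊕ Fin M → 𝕜)} (hU : IsOpen U) :
    IsHamiltonianStructure U gMat gammaSym :=
  isHamiltonianStructure_affine (κ := 1) (μ := 0) hU mMat_symm (fun u i j => by simp [gMat])
    fun u i j k => by simp [gammaSym]

/-! ### Degeneracy: determinant, kernel and rank -/

theorem gMat_eq (u : Fin N ⊕ Fin M → 𝕜) :
    gMat u = Matrix.diagonal u * mMat 𝕜 N M * Matrix.diagonal u := by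
  ext i j
  rw [Matrix.mul_diagonal, Matrix.diagonal_mul, gMat]
  ring

theorem mMat_mulVec (x : Fin N ⊕ Fin M → 𝕜) (i : Fin N ⊕ Fin M) :
    (mMat 𝕜 N M).mulVec x i = ∑ j, x j - ((eps i : ℤ) : 𝕜) * ((N : 𝕜) - M) * x i :=
  sum_mMat_mul i x

theorem mMat_mulVec_eps : (mMat 𝕜 N M).mulVec (fun i => ((eps i : ℤ) : 𝕜)) = 0 := by
  ext i
  have h := eps_mul_self (𝕜 := 𝕜) i
  have hs : ∑ j : Fin N ⊕ Fin M, ((eps j : ℤ) : 𝕜) = (N : 𝕜) - M := by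
    simp [eps, sub_eq_add_neg]
  rw [mMat_mulVec, hs, Pi.zero_apply]
  linear_combination (-((N : 𝕜) - M)) * h

theorem eps_cast_ne_zero (hNM : M < N) : (fun i : Fin N ⊕ Fin M => ((eps i : ℤ) : 𝕜)) ≠ 0 := fun h => by
  have := congrFun h (Sum.inl ⟨0, by omega⟩)
  simp [eps] at this

/-- The equation `m x = 0` says `ε_i (N-M) x_i = ∑_j x_j` for every `i`, so `x` is a multiple of
`ε`; conversely `ε` satisfies it since `∑ ε_j = N - M` and `ε_i² = 1`. -/
theorem ker_mMat (hNM : M < N) : LinearMap.ker (mMat 𝕜 N M).mulVecLin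
    = Submodule.span 𝕜 {fun i : Fin N ⊕ Fin M => ((eps i : ℤ) : 𝕜)} := by
  have hd := sub_ne_zero_of_lt 𝕜 hNM
  ext x
  rw [LinearMap.mem_ker, Matrix.mulVecLin_apply, Submodule.mem_span_singleton]
  constructor
  · intro h
    refine ⟨(∑ j, x j) / ((N : 𝕜) - M), funext fun i => ?_⟩
    have hi := congrFun h i
    rw [mMat_mulVec, Pi.zero_apply, sub_eq_zero] at hi
    rw [Pi.smul_apply, smul_eq_mul, hi]
    field_simp
    linear_combination x i * eps_mul_self (𝕜 := 𝕜) i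
  · rintro ⟨c, rfl⟩
    rw [Matrix.mulVec_smul, mMat_mulVec_eps, smul_zero]

theorem det_gMat (hNM : M < N) (u : Fin N ⊕ Fin M → 𝕜) : (gMat u).det = 0 := by
  have h : (mMat 𝕜 N M).det = 0 :=
    Matrix.exists_mulVec_eq_zero_iff.1 ⟨_, eps_cast_ne_zero hNM, mMat_mulVec_eps⟩
  rw [gMat_eq, Matrix.det_mul, Matrix.det_mul, h, mul_zero, zero_mul]

theorem rank_gMat (hNM : M < N) {u : Fin N ⊕ Fin M → 𝕜} (hu : ∀ i, u i ≠ 0) :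
    (gMat u).rank = N + M - 1 := by
  have hdet : IsUnit (Matrix.diagonal u).det := by
    rw [Matrix.det_diagonal]
    exact (Finset.prod_ne_zero_iff.2 fun i _ => hu i).isUnit
  -- Where no `u^i` vanishes the diagonal factors are invertible, so the rank is that of `m`, found
  -- by rank–nullity.
  rw [gMat_eq, Matrix.rank_mul_eq_left_of_isUnit_det _ _ hdet,
    Matrix.rank_mul_eq_right_of_isUnit_det _ _ hdet, Matrix.rank]
  have h := LinearMap.finrank_range_add_finrank_ker (mMat 𝕜 N M).mulVecLin
  rw [ker_mMat hNM, finrank_span_singleton (eps_cast_ne_zero hNM), Module.finrank_fintype_fun_eq_card,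
    Fintype.card_sum, Fintype.card_fin, Fintype.card_fin] at h
  omega

end Structure

end RationalLax

end

theorem theorem7 {𝕜 : Type*} [RCLike 𝕜] (N M : ℕ) (hNM : M < N) :
    -- (A) `m^{ij} 𝒟` is a Hamiltonian operator, and the flows are Hamiltonian with respect to it.
    ((∀ U : Set (Fin N ⊕ Fin M → 𝕜), IsOpen U →
        RationalLax.IsHamiltonianStructure U (fun _ => RationalLax.mMat 𝕜 N M) 0) ∧
      ∀ n : ℕ, 1 ≤ n →
        (∀ u : Fin N ⊕ Fin M → 𝕜, RationalLax.charge n u = RationalLax.chargeSum n u) ∧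
        ∀ (Ω : Set (ℝ × ℝ)) (w u : ℝ → ℝ → Fin N ⊕ Fin M → 𝕜), IsOpen Ω →
          ContDiffOn ℝ 1 (fun z : ℝ × ℝ => w z.1 z.2) Ω →
          (∀ x τ i, u x τ i = NormedSpace.exp (w x τ i)) →
            (RationalLax.IsModifiedFlow n Ω u ↔
              RationalLax.IsHamiltonianFlow (fun _ => RationalLax.mMat 𝕜 N M) 0
                (RationalLax.hamDensityLog n) Ω w) ∧
            (RationalLax.IsModifiedFlow n Ω u ↔
              RationalLax.IsHamiltonianFlow RationalLax.gMat RationalLax.gammaSym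
                (RationalLax.hamDensity n) Ω u) ∧
            -- the numerator and the denominator of the Lax function have no common root
            ((∀ x τ, (x, τ) ∈ Ω → ∀ (i : Fin N) (j : Fin M), u x τ (Sum.inl i) ≠ u x τ (Sum.inr j)) →
              (RationalLax.IsLaxFlow n Ω u ↔
                RationalLax.IsHamiltonianFlow (fun _ => RationalLax.mMat 𝕜 N M) 0
                  (RationalLax.hamDensityLog n) Ω w))) ∧
    -- (B) The pair `(g, Γ)` defines a degenerate Hamiltonian structure.
    (RationalLax.GrinbergDorfman (Set.univ : Set (Fin N ⊕ Fin M → 𝕜))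
        RationalLax.gMat RationalLax.gammaSym ∧
      (∀ U : Set (Fin N ⊕ Fin M → 𝕜), IsOpen U →
        RationalLax.IsHamiltonianStructure U RationalLax.gMat RationalLax.gammaSym) ∧
      (∀ u : Fin N ⊕ Fin M → 𝕜, (RationalLax.gMat u).det = 0) ∧
      ∀ u : Fin N ⊕ Fin M → 𝕜, (∀ i, u i ≠ 0) → (RationalLax.gMat u).rank = N + M - 1) := by
  refine ⟨⟨fun U hU => RationalLax.isHamiltonianStructure_mMat hU, fun n hn =>
      ⟨RationalLax.charge_eq_chargeSum n, fun Ω w u hΩ hw hu => ?_⟩⟩,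
    RationalLax.grinbergDorfman_gMat, fun U hU => RationalLax.isHamiltonianStructure_gMat hU,
    RationalLax.det_gMat hNM, fun u hu => RationalLax.rank_gMat hNM hu⟩
  have hu' := RationalLax.contDiffOn_exp_fields hw hu
  have hlog := RationalLax.isHamiltonianFlow_hamDensityLog_iff hNM hn hΩ hw hu
  have hmod := RationalLax.isModifiedFlow_iff (Ω := Ω) (u := u) hn
  exact ⟨hmod.trans hlog.symm,
    hmod.trans (RationalLax.isHamiltonianFlow_hamDensity_iff hNM hn).symm,
    fun hne => (RationalLax.isLaxFlow_iff hNM hn hΩ hu' hne).trans hlog.symm⟩
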